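/- Let $G=(V,E)$ be a finite simple undirected graph. A vertex cover of $G$ is a set $S\subseteq V$ that contains at least one endpoint of every edge; it is minimum if no vertex cover of $G$ has smaller cardinality. An edge $\{i,j\}\in E$ is a strong edge if some minimum vertex cover of $G$ contains both $i$ and $j$. The strong edge problem is the search problem: given a finite simple graph $G$ on the vertex set $\{0,\dots,n-1\}$, described by the number $n$ and a list of its edges, output a strong edge of $G$, or report that $G$ has none. Theorem. The strong edge problem is NP-hard (under polynomial-time Turing reductions). That is, for every language $L\subseteq\{0,1\}^*$ in NP there are an oracle machine $M$ and a polynomial $p$ such that, for every function $f$ that returns a correct answer to every instance of the strong edge problem (and anything at all on strings that describe no graph), the machine $M$ with oracle $f$ decides $L$ and halts on every input $x$ within $p(|x|)$ steps, each oracle call counting as one step. -/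

import Mathlib

/-!
Deterministic machines with an oracle, the classes P and NP, NP-hardness of search problems under
polynomial-time Turing reductions, and the strong edge problem.
-/

namespace Complexity

/-- The instructions of a machine with control states `Q` and stacks indexed by `K`. Each stack
holds bits, the top of the stack being the head of the list. -/
inductive Instr (K Q : Type) : Type
  /-- `push k b q`: put the bit `b` on top of stack `k` and go to state `q`. -/
  | push (k : K) (b : Bool) (q : Q) : Instr K Q
  /-- `pop k next`: remove the top bit `b` of stack `k` and go to state `next (some b)`;
  if stack `k` is empty, leave it empty and go to state `next none`. -/
  | pop (k : K) (next : Option Bool → Q) : Instr K Q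
  /-- `query q`: replace the whole content of the oracle stack by the oracle's answer to it,
  and go to state `q`. -/
  | query (q : Q) : Instr K Q
  /-- `halt b`: stop, accepting if `b = true` and rejecting if `b = false`. -/
  | halt (b : Bool) : Instr K Q

/-- A deterministic oracle machine: a finite control with finitely many stacks of bits. (Two stacks
make a Turing machine tape, with the head between them; so this is a multi-tape Turing machine,
in the style of Mathlib's `Turing.FinTM2`, with one additional instruction for oracle calls.) -/
structure Machine where
  /-- the index type of the stacks -/
  K : Type
  /-- the type of control states -/
  Q : Type
  [decEqK : DecidableEq K]
  [fintypeK : Fintype K]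
  [fintypeQ : Fintype Q]
  /-- the stack that holds the input at the start -/
  inp : K
  /-- the stack used to communicate with the oracle -/
  orc : K
  /-- the initial control state -/
  start : Q
  /-- the program -/
  instr : Q → Instr K Q

attribute [instance] Machine.decEqK Machine.fintypeK Machine.fintypeQ

namespace Machine

/-- A configuration: the control state and the contents of all stacks. -/
structure Cfg (M : Machine) where
  state : M.Q
  stk : M.K → List Bool

/-- The initial configuration on input `x`: all stacks but the input stack are empty. -/
def init (M : Machine) (x : List Bool) : M.Cfg :=
  ⟨M.start, Function.update (fun _ => []) M.inp x⟩

/-- One step of computation with oracle `f`. A halted machine stays as it is. -/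
def step (M : Machine) (f : List Bool → List Bool) (c : M.Cfg) : M.Cfg :=
  match M.instr c.state with
  | .push k b q => ⟨q, Function.update c.stk k (b :: c.stk k)⟩
  | .pop k next => ⟨next (c.stk k).head?, Function.update c.stk k (c.stk k).tail⟩
  | .query q => ⟨q, Function.update c.stk M.orc (f (c.stk M.orc))⟩
  | .halt _ => c

/-- With oracle `f` and on input `x`, the machine halts within `t` steps with verdict `b`. -/
def HaltsWithin (M : Machine) (f : List Bool → List Bool) (x : List Bool) (t : ℕ) (b : Bool) :
    Prop :=
  M.instr ((M.step f)^[t] (M.init x)).state = .halt b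

/-- With oracle `f`, the machine decides the language `L`, and it halts on every input `x` within
`p(|x|)` steps. An oracle call counts as one step. -/
def DecidesInTime (M : Machine) (f : List Bool → List Bool) (L : Language Bool)
    (p : Polynomial ℕ) : Prop :=
  ∀ x : List Bool, ∃ b : Bool, M.HaltsWithin f x (p.eval x.length) b ∧ (b = true ↔ x ∈ L)

/-- The program contains no oracle call. -/
def OracleFree (M : Machine) : Prop :=
  ∀ q q' : M.Q, M.instr q ≠ .query q'

end Machine

/-- The class P: languages decided in polynomial time by a machine that makes no oracle calls
(so that the oracle, here `id`, is irrelevant). -/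
def P : Set (Language Bool) :=
  {L | ∃ (M : Machine) (p : Polynomial ℕ), M.OracleFree ∧ M.DecidesInTime id L p}

/-- The pair `(x, w)` as one bit string: `1 x₁ 1 x₂ … 1 xₙ 0 w`. -/
def pair (x w : List Bool) : List Bool :=
  x.flatMap (fun b => [true, b]) ++ false :: w

/-- The class NP: `L` is in NP if for some language `V` in P and some polynomial `p`, a string `x`
is in `L` iff there is a certificate `w` of length `p(|x|)` such that `(x, w)` is in `V`. -/
def NP : Set (Language Bool) :=
  {L | ∃ V ∈ P, ∃ p : Polynomial ℕ,
    ∀ x : List Bool, x ∈ L ↔ ∃ w : List Bool, w.length = p.eval x.length ∧ pair x w ∈ V}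

/-- A search problem: `R x y` says that `y` is a correct answer to the instance `x`. The strings `x`
for which there is no `y` with `R x y` are not instances of the problem. -/
abbrev SearchProblem : Type := List Bool → List Bool → Prop

/-- `f` solves the search problem `R`: it gives a correct answer to each instance. Nothing is
required of `f` on strings that are not instances. -/
def Solves (f : List Bool → List Bool) (R : SearchProblem) : Prop :=
  ∀ x, (∃ y, R x y) → R x (f x)

/-- A search problem `R` is NP-hard if each language in NP is polynomial-time Turing reducible to
it: one oracle machine decides the language in polynomial time with each oracle that solves `R`. -/
def NPHard (R : SearchProblem) : Prop :=
  ∀ L ∈ NP, ∃ (M : Machine) (p : Polynomial ℕ),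
    ∀ f : List Bool → List Bool, Solves f R → M.DecidesInTime f L p

/-- The self-delimiting unary code of a number: `1ⁿ 0`. -/
def unary (n : ℕ) : List Bool :=
  List.replicate n true ++ [false]

/-- The string `x` describes the graph `G` on `n` vertices: it consists of the code of `n` followed
by the codes of the two ends of each edge, for the edges of `G` listed in some order. -/
def Describes {n : ℕ} (x : List Bool) (G : SimpleGraph (Fin n)) : Prop :=
  ∃ l : List (Fin n × Fin n),
    (∀ i j, G.Adj i j ↔ (i, j) ∈ l ∨ (j, i) ∈ l) ∧
    x = unary n ++ l.flatMap (fun e => unary e.1 ++ unary e.2)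

end Complexity

/-- The set `S` is a vertex cover of smallest cardinality. -/
def SimpleGraph.IsMinVertexCover {V : Type*} (G : SimpleGraph V) (S : Set V) : Prop :=
  G.IsVertexCover S ∧ S.encard = G.vertexCoverNum

/-- The pair `(i, j)` is a strong edge: an edge both of whose ends lie in some minimum vertex
cover. -/
def SimpleGraph.IsStrongEdge {V : Type*} (G : SimpleGraph V) (i j : V) : Prop :=
  G.Adj i j ∧ ∃ S : Set V, G.IsMinVertexCover S ∧ i ∈ S ∧ j ∈ S

namespace Complexity

/-- The strong edge problem: an instance is a description of a finite graph `G`; a correct answer is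
the pair of codes of the ends of a strong edge of `G`, or the empty string if `G` has none. -/
def StrongEdgeProblem : SearchProblem := fun x y =>
  ∃ (n : ℕ) (G : SimpleGraph (Fin n)), Describes x G ∧
    ((∃ i j : Fin n, G.IsStrongEdge i j ∧ y = unary i ++ unary j) ∨
      ((∀ i j : Fin n, ¬ G.IsStrongEdge i j) ∧ y = []))

end Complexity

/-!
# The strong edge problem is NP-hard

The proof has two independent halves.

*Strong edges give minimum vertex covers.* An oracle for strong edges lets one find a minimum vertex
cover of a graph `G` by growing a set `D` that is part of one, until no edge of `G - D` is left. If
the oracle finds a strong edge of `G - D`, both its ends go into `D`, because `D` together with any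
minimum vertex cover of `G - D` is a minimum vertex cover of `G`
(`SimpleGraph.exists_isMinVertexCover_union`). If `G - D` has edges but no strong ones, take an edge
`uv`, attach a new vertex to `u`, and ask again. If the new graph has no strong edge, then `u` is in
some minimum vertex cover of `G - D`: otherwise a minimum vertex cover of `G - D` together with `u`
would be one of the new graph, and would contain both `u` and `v`. If the new graph has a strong
edge, then `v` is in some minimum vertex cover of `G - D`: otherwise `u` is in all of them, hence
each minimum vertex cover of the new graph is one of `G - D`, and the new graph has no strong edge
either. This takes at most `n` rounds, see `iterate_round_spec`.

*Vertex cover is NP-hard.* An accepting computation of the verifier is a tableau whose entry at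
time `t` and depth `i` holds the state at time `t` and the bit at depth `i` of each stack. Counting
depth from the top of each stack makes all conditions concern at most two entries: a push or a pop
shifts a stack by one place, and the state is repeated all along a row. So a tableau is a filling of
a square with symbols in which no two entries clash, hence an independent set with one vertex for
each place in the graph of all pairs of a place and a symbol; its complement is a vertex cover of
known size (`Machine.exists_isVertexCover_clash_iff`). Entries close to the deep end of the square
are not controlled, but this does not reach the top within the time considered
(`Machine.IsTableau.exists_haltsWithin`).

To have both halves carried out by a machine, `PolyTimeO` expresses that a function of a tuple of
strings, unary numbers and bits is computed by a program fragment in polynomial time, uniformly in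
the oracle. It is closed under composition, case distinction, folding along a list with results of
polynomial size, and oracle calls with answers of polynomial length; everything else is derived from
that without any further reference to machines.
-/

namespace Complexity

open Function

/-! ### Program fragments -/

/-- Contents of all stacks of a machine whose stacks are numbered by `ℕ`. -/
abbrev Store : Type := ℕ → List Bool

/-- An oracle for a search problem. -/
abbrev Oracle : Type := List Bool → List Bool

/-- Rename the stacks along `h` and the target states along `g`. -/
def Instr.map {K K' Q Q' : Type} (h : K → K') (g : Q → Q') : Instr K Q → Instr K' Q'
  | .push k b q => .push (h k) b (g q)
  | .pop k next => .pop (h k) (fun o => g (next o))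
  | .query q => .query (g q)
  | .halt b => .halt b

/-- The effect of an instruction: the next state and store, where stack `0` is the oracle stack.
A `halt` has no successor. -/
def Instr.exec {Q : Type} (f : Oracle) : Instr ℕ Q → Store → Option (Q × Store)
  | .push k b q, s => some (q, update s k (b :: s k))
  | .pop k next, s => some (next (s k).head?, update s k (s k).tail)
  | .query q, s => some (q, update s 0 (f (s 0)))
  | .halt _, _ => none

theorem Instr.exec_map {Q Q' : Type} (f : Oracle) (g : Q → Q') {i : Instr ℕ Q} {s : Store}
    {q : Q} {s' : Store} (h : i.exec f s = some (q, s')) :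
    (i.map id g).exec f s = some (g q, s') := by
  cases i <;> simp_all [Instr.exec, Instr.map]

/-- A program fragment, with stacks numbered by `ℕ`, of which stack `0` is the oracle stack. The
states are those of the type `Q` and the exit `none`, at which the next fragment takes over. -/
structure Frag where
  /-- the type of states other than the exit -/
  Q : Type
  [fintypeQ : Fintype Q]
  /-- the initial state -/
  start : Option Q
  /-- the program -/
  instr : Q → Instr ℕ (Option Q)

attribute [instance] Frag.fintypeQ

namespace Frag

/-- `A.Reach f t o s o' s'`: with oracle `f`, the fragment `A` gets from state `o` and store `s` to
state `o'` and store `s'` in at most `t` steps. -/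
inductive Reach (A : Frag) (f : Oracle) : ℕ → Option A.Q → Store → Option A.Q → Store → Prop
  | refl (t : ℕ) (o : Option A.Q) (s : Store) : Reach A f t o s o s
  | step {t : ℕ} {q : A.Q} {s s₁ s' : Store} {o o' : Option A.Q} :
      (A.instr q).exec f s = some (o, s₁) → Reach A f t o s₁ o' s' →
      Reach A f (t + 1) (some q) s o' s'

theorem Reach.mono {A : Frag} {f : Oracle} {t t' : ℕ} {o s o' s'} (h : A.Reach f t o s o' s')
    (ht : t ≤ t') : A.Reach f t' o s o' s' := by
  induction h generalizing t' with
  | refl => exact .refl _ _ _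
  | step h1 _ ih =>
    obtain ⟨u, rfl⟩ : ∃ u, t' = u + 1 := ⟨t' - 1, by omega⟩
    exact .step h1 (ih (by omega))

theorem Reach.trans {A : Frag} {f : Oracle} {t t' : ℕ} {o s o₁ s₁ o' s'}
    (h : A.Reach f t o s o₁ s₁) (h' : A.Reach f t' o₁ s₁ o' s') :
    A.Reach f (t + t') o s o' s' := by
  induction h with
  | refl => exact h'.mono (by omega)
  | @step t _ _ _ _ _ _ h1 _ ih =>
    have := Reach.step h1 (ih h')
    exact this.mono (by omega)

/-- A fragment that is part of another one, up to renaming of states, keeps its computations. -/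
theorem Reach.embed {A B : Frag} {f : Oracle} (φ : Option A.Q → Option B.Q)
    (hφ : ∀ q, ∃ q', φ (some q) = some q' ∧ B.instr q' = (A.instr q).map id φ)
    {t : ℕ} {o s o' s'} (h : A.Reach f t o s o' s') : B.Reach f t (φ o) s (φ o') s' := by
  induction h with
  | refl => exact .refl _ _ _
  | @step t q _ _ _ _ _ h1 _ ih =>
    obtain ⟨q', h2, h3⟩ := hφ q
    rw [h2]
    exact .step (by rw [h3]; exact Instr.exec_map f φ h1) ih

/-- `A.Runs f t s s'`: with oracle `f`, the fragment `A`, started on the store `s`, exits with the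
store `s'` after at most `t` steps. -/
def Runs (A : Frag) (f : Oracle) (t : ℕ) (s s' : Store) : Prop :=
  A.Reach f t A.start s none s'

theorem Runs.mono {A : Frag} {f : Oracle} {t t' : ℕ} {s s'} (h : A.Runs f t s s')
    (ht : t ≤ t') : A.Runs f t' s s' :=
  Reach.mono h ht

theorem Runs.congr {A : Frag} {f : Oracle} {t t' : ℕ} {s s₁ s'} (h : A.Runs f t s s₁)
    (ht : t ≤ t') (hs : s₁ = s') : A.Runs f t' s s' :=
  hs ▸ h.mono ht

/-- The fragment that does nothing. -/
def skip : Frag := ⟨Empty, none, Empty.elim⟩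

theorem runs_skip (f : Oracle) (t : ℕ) (s : Store) : skip.Runs f t s s := .refl _ _ _

/-- The fragment with one instruction. -/
def single (i : Instr ℕ (Option Unit)) : Frag := ⟨Unit, some (), fun _ => i⟩

/-- Push the bit `b` on stack `k`. -/
def push (k : ℕ) (b : Bool) : Frag := single (.push k b none)

theorem runs_push (f : Oracle) (k : ℕ) (b : Bool) (s : Store) :
    (push k b).Runs f 1 s (update s k (b :: s k)) :=
  .step rfl (.refl 0 _ _)

/-- Remove the top of stack `k`. -/
def pop (k : ℕ) : Frag := single (.pop k fun _ => none)

theorem runs_pop (f : Oracle) (k : ℕ) (s : Store) :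
    (pop k).Runs f 1 s (update s k (s k).tail) :=
  .step rfl (.refl 0 _ _)

/-- Call the oracle. -/
def query : Frag := single (.query none)

theorem runs_query (f : Oracle) (s : Store) : query.Runs f 1 s (update s 0 (f (s 0))) :=
  .step rfl (.refl 0 _ _)

/-- Run `A`, then `B`. -/
def seq (A B : Frag) : Frag where
  Q := A.Q ⊕ B.Q
  start := A.start.elim (B.start.map .inr) (fun q => some (.inl q))
  instr
    | .inl q => (A.instr q).map id (fun o => o.elim (B.start.map .inr) (fun q => some (.inl q)))
    | .inr q => (B.instr q).map id (Option.map .inr)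

theorem Runs.seq {A B : Frag} {f : Oracle} {t t' : ℕ} {s s₁ s'} (h : A.Runs f t s s₁)
    (h' : B.Runs f t' s₁ s') : (A.seq B).Runs f (t + t') s s' :=
  Reach.trans
    (Reach.embed (B := A.seq B) (fun o => o.elim (B.start.map .inr) (fun q => some (.inl q)))
      (fun _ => ⟨_, rfl, rfl⟩) h)
    (Reach.embed (B := A.seq B) (Option.map .inr) (fun _ => ⟨_, rfl, rfl⟩) h')

/-- Pop stack `k`, and run the fragment chosen by the outcome. -/
def branch (k : ℕ) (A : Option Bool → Frag) : Frag where
  Q := Option (Σ o, (A o).Q)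
  start := some none
  instr
    | none => .pop k (fun o => (A o).start.map fun q => some ⟨o, q⟩)
    | some ⟨o, q⟩ => ((A o).instr q).map id (Option.map fun q => some ⟨o, q⟩)

theorem runs_branch {k : ℕ} {A : Option Bool → Frag} {f : Oracle} {t : ℕ} {s s'}
    (h : (A (s k).head?).Runs f t (update s k (s k).tail) s') :
    (branch k A).Runs f (t + 1) s s' :=
  .step rfl (Reach.embed (B := branch k A) (Option.map fun q => some ⟨(s k).head?, q⟩)
    (fun _ => ⟨_, rfl, rfl⟩) h)

/-- Pop stack `k` until it is empty, running `A b` for each bit `b` found. -/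
def loop (k : ℕ) (A : Bool → Frag) : Frag where
  Q := Option (Σ b, (A b).Q)
  start := some none
  instr
    | none => .pop k (fun o => o.elim none
        (fun b => (A b).start.elim (some none) (fun q => some (some ⟨b, q⟩))))
    | some ⟨b, q⟩ => ((A b).instr q).map id
        (fun o => o.elim (some none) (fun q => some (some ⟨b, q⟩)))

theorem runs_loop_nil {k : ℕ} {A : Bool → Frag} {f : Oracle} {s : Store} (h : s k = []) :
    (loop k A).Runs f 1 s s :=
  .step (s₁ := s) (by simp [loop, Instr.exec, h]) (.refl 0 _ _)

theorem runs_loop_cons {k : ℕ} {A : Bool → Frag} {f : Oracle} {t t' : ℕ} {s s₁ s' : Store}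
    {b : Bool} {l : List Bool} (h : s k = b :: l) (h₁ : (A b).Runs f t (update s k l) s₁)
    (h' : (loop k A).Runs f t' s₁ s') : (loop k A).Runs f (t + t' + 1) s s' := by
  refine .step (o := (A b).start.elim (some none) (fun q => some (some ⟨b, q⟩)))
    (s₁ := update s k l) (by simp [loop, Instr.exec, h]) (Reach.trans
      (Reach.embed (B := loop k A) (fun o => o.elim (some none) (fun q => some (some ⟨b, q⟩)))
      (fun _ => ⟨_, rfl, rfl⟩) h₁) h')

/-! ### Moving and copying stacks -/

/-- Empty stack `k`. -/
def clear (k : ℕ) : Frag := loop k fun _ => skip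

theorem runs_clear (f : Oracle) (k : ℕ) (s : Store) :
    (clear k).Runs f ((s k).length + 1) s (update s k []) := by
  generalize hl : s k = l
  induction l generalizing s with
  | nil =>
    exact (runs_loop_nil hl).congr (by simp) (by rw [← hl, update_eq_self])
  | cons b l ih =>
    have := runs_loop_cons hl (runs_skip f 0 _) (ih (update s k l) (by simp))
    simp only [update_idem] at this
    exact this.mono (by simp)

/-- Move stack `i` to the top of stack `j`, reversing it. -/
def moveRev (i j : ℕ) : Frag := loop i fun b => push j b

theorem runs_moveRev (f : Oracle) {i j : ℕ} (hij : i ≠ j) (s : Store) :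
    (moveRev i j).Runs f (2 * (s i).length + 1) s
      (update (update s i []) j ((s i).reverse ++ s j)) := by
  generalize hl : s i = l
  induction l generalizing s with
  | nil =>
    exact (runs_loop_nil hl).congr (by simp)
      (by funext k; simp only [update_apply]; split_ifs <;> simp_all)
  | cons b l ih =>
    have := runs_loop_cons hl (runs_push f j b _) (ih _ (by simp [hij]))
    exact this.congr (by simp; omega)
      (by funext k; simp only [update_apply]; split_ifs <;> simp_all)

/-- Move stack `i` to the stack `j`, by way of stack `t`. -/
def move (t i j : ℕ) : Frag := (moveRev i t).seq (moveRev t j)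

theorem runs_move (f : Oracle) {t i j : ℕ} (hij : i ≠ j) (hi : i ≠ t) (hj : j ≠ t) (s : Store)
    (h0 : s t = []) (hsj : s j = []) :
    (move t i j).Runs f (4 * (s i).length + 2) s (update (update s i []) j (s i)) := by
  have := (runs_moveRev f hi s).seq (runs_moveRev f (i := t) (j := j) (Ne.symm hj) _)
  exact this.congr (by simp [h0]; omega)
    (by funext k; simp only [update_apply]; split_ifs <;> simp_all)

/-- Copy stack `i` to stack `j`, by way of stack `0`. -/
def copy (i j : ℕ) : Frag := (moveRev i 0).seq (loop 0 fun b => (push i b).seq (push j b))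

theorem runs_copy (f : Oracle) {i j : ℕ} (hij : i ≠ j) (hi : i ≠ 0) (hj : j ≠ 0) (s : Store)
    (h0 : s 0 = []) (hsj : s j = []) :
    (copy i j).Runs f (5 * (s i).length + 2) s (update s j (s i)) := by
  have key : ∀ (l : List Bool) (s : Store), s 0 = l →
      (loop 0 fun b => (push i b).seq (push j b)).Runs f (3 * l.length + 1) s
        (update (update (update s 0 []) i (l.reverse ++ s i)) j (l.reverse ++ s j)) := by
    intro l
    induction l with
    | nil =>
      intro s hl
      exact (runs_loop_nil hl).congr (by simp)
        (by funext k; simp only [update_apply]; split_ifs <;> simp_all)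
    | cons b l ih =>
      intro s hl
      have := runs_loop_cons hl ((runs_push f i b _).seq (runs_push f j b _))
        (ih _ (by simp [hi.symm, hj.symm]))
      exact this.congr (by simp; omega)
        (by funext k; simp only [update_apply]; split_ifs <;> simp_all)
  have := (runs_moveRev f hi s).seq (key (s i).reverse _ (by simp [h0]))
  exact this.congr (by simp; omega)
    (by funext k; simp only [update_apply]; split_ifs <;> simp_all)

end Frag

end Complexity

namespace Complexity

open Function Polynomial

/-! ### Stores given by lists of registers -/

/-- The store whose stacks `1, 2, …` are the entries of `L`; the oracle stack `0` and the stacks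
beyond `L` are empty. -/
def store (L : List (List Bool)) : Store
  | 0 => []
  | r + 1 => L.getD r []

@[simp] theorem store_zero (L : List (List Bool)) : store L 0 = [] := rfl

theorem store_mid {L₁ L₂ : List (List Bool)} {a : List Bool} {i : ℕ} (hi : i = L₁.length) :
    store (L₁ ++ a :: L₂) (i + 1) = a := by
  subst hi; simp [store]

theorem update_store_mid {L₁ L₂ : List (List Bool)} {a b : List Bool} {i : ℕ}
    (hi : i = L₁.length) : update (store (L₁ ++ a :: L₂)) (i + 1) b = store (L₁ ++ b :: L₂) := by
  subst hi
  funext r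
  rcases r with _ | r
  · simp [store]
  · by_cases h : r = L₁.length
    · subst h; simp [store]
    · rw [update_of_ne (by omega)]
      simp only [store, List.getD_eq_getElem?_getD, List.getElem?_append]
      split_ifs with h'
      · rfl
      · obtain ⟨m, hm⟩ : ∃ m, r - L₁.length = m + 1 := ⟨r - L₁.length - 1, by omega⟩
        simp [hm]

theorem store_append_nil (L : List (List Bool)) : store (L ++ [[]]) = store L := by
  funext r
  rcases r with _ | r
  · rfl
  · simp only [store, List.getD_eq_getElem?_getD, List.getElem?_append]
    split_ifs with h'
    · rfl
    · rw [List.getElem?_eq_none (by omega : L.length ≤ r)]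
      cases r - L.length <;> simp

theorem store_end {L : List (List Bool)} {i : ℕ} (hi : i = L.length) : store L (i + 1) = [] := by
  subst hi; simp [store]

theorem update_store_end {L : List (List Bool)} {b : List Bool} {i : ℕ} (hi : i = L.length) :
    update (store L) (i + 1) b = store (L ++ [b]) := by
  rw [← store_append_nil, update_store_mid hi]

/-- The total length of the entries of `L`. -/
def total (L : List (List Bool)) : ℕ := (L.map List.length).sum

@[simp] theorem total_nil : total [] = 0 := rfl

@[simp] theorem total_cons (a : List Bool) (L : List (List Bool)) :
    total (a :: L) = a.length + total L := rfl

@[simp] theorem total_append (L L' : List (List Bool)) : total (L ++ L') = total L + total L' := by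
  simp [total]

namespace Frag

/-- Copy the `k` registers from number `i` on to the `k` registers from number `j` on. -/
def copyBlock : ℕ → ℕ → ℕ → Frag
  | _, _, 0 => skip
  | i, j, k + 1 => (copy (i + 1) (j + 1)).seq (copyBlock (i + 1) (j + 1) k)

theorem runs_copyBlock (f : Oracle) (a : List (List Bool)) {i j : ℕ} {L₁ L₂ : List (List Bool)}
    (hi : i = L₁.length) (hj : j = (L₁ ++ a ++ L₂).length) :
    (copyBlock i j a.length).Runs f (5 * total a + 2 * a.length) (store (L₁ ++ a ++ L₂))
      (store (L₁ ++ a ++ L₂ ++ a)) := by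
  induction a generalizing L₁ L₂ i j with
  | nil => simpa [copyBlock] using runs_skip f _ _
  | cons x a ih =>
    have hij : i + 1 ≠ j + 1 := by simp at hj; omega
    have h1 := runs_copy f hij (by omega) (by omega) (store (L₁ ++ (x :: a) ++ L₂)) rfl
      (store_end hj)
    rw [update_store_end hj, List.append_assoc, List.cons_append, store_mid hi] at h1
    have h2 := ih (L₁ := L₁ ++ [x]) (L₂ := L₂ ++ [x]) (i := i + 1) (j := j + 1) (by simp [hi])
      (by simp [hj]; omega)
    have h3 := h1.seq (B := copyBlock (i + 1) (j + 1) a.length) (by simpa using h2)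
    have h4 := h3.congr (t' := 5 * total (x :: a) + 2 * (x :: a).length)
      (s' := store (L₁ ++ x :: a ++ L₂ ++ x :: a)) (by simp; omega) (by simp)
    simpa [copyBlock] using h4

/-- Move the `n` registers above register `i`, which is empty, down by one. -/
def shiftDown : ℕ → ℕ → Frag
  | _, 0 => skip
  | i, n + 1 => (move 0 (i + 2) (i + 1)).seq (shiftDown (i + 1) n)

theorem runs_shiftDown (f : Oracle) (C : List (List Bool)) {i : ℕ} {L : List (List Bool)}
    (hi : i = L.length) :
    (shiftDown i C.length).Runs f (4 * total C + 2 * C.length) (store (L ++ [] :: C))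
      (store (L ++ C)) := by
  induction C generalizing L i with
  | nil => simpa [shiftDown, store_append_nil] using runs_skip f _ _
  | cons c C ih =>
    have e (b : List Bool) : L ++ [] :: b :: C = (L ++ [[]]) ++ b :: C := by simp
    have h0 : store (L ++ [] :: c :: C) (i + 2) = c := by rw [e, store_mid (by simp [hi])]
    have h0' : update (store (L ++ [] :: c :: C)) (i + 2) [] = store (L ++ [] :: [] :: C) := by
      rw [e, update_store_mid (by simp [hi]), ← e]
    have h1 := runs_move f (t := 0) (i := i + 2) (j := i + 1) (by omega) (by omega) (by omega)
      (store (L ++ [] :: c :: C)) rfl (store_mid hi)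
    rw [h0, h0', update_store_mid hi] at h1
    have h2 := ih (L := L ++ [c]) (i := i + 1) (by simp [hi])
    have h3 := h1.seq (B := shiftDown (i + 1) C.length) (by simpa using h2)
    exact h3.congr (by simp; omega) (by simp)

/-- Delete the `m` registers from number `i` on, and move the `n` registers above them down. -/
def squeeze (i : ℕ) : ℕ → ℕ → Frag
  | 0, _ => skip
  | m + 1, n => ((clear (i + 1)).seq (shiftDown i (m + n))).seq (squeeze i m n)

theorem runs_squeeze (f : Oracle) (B C : List (List Bool)) {i : ℕ} {L : List (List Bool)}
    (hi : i = L.length) :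
    (squeeze i B.length C.length).Runs f
      (B.length * (5 * (total B + total C) + 2 * (B.length + C.length) + 1))
      (store (L ++ B ++ C)) (store (L ++ C)) := by
  induction B with
  | nil => simpa [squeeze] using runs_skip f _ _
  | cons b B ih =>
    have h1 := runs_clear f (i + 1) (store (L ++ b :: (B ++ C)))
    rw [store_mid hi, update_store_mid hi] at h1
    have h2 := runs_shiftDown f (B ++ C) hi
    have h3 := (h1.seq h2).seq (B := squeeze i B.length C.length) (by simpa using ih)
    have := h3.congr (t' := (b :: B).length * (5 * (total (b :: B) + total C) +
      2 * ((b :: B).length + C.length) + 1)) (by simp; nlinarith) rfl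
    simpa [squeeze] using this

/-- Push the list `l` on stack `r`. -/
def pushList (r : ℕ) : List Bool → Frag
  | [] => skip
  | b :: l => (pushList r l).seq (push r b)

theorem runs_pushList (f : Oracle) (r : ℕ) (l : List Bool) (s : Store) :
    (pushList r l).Runs f l.length s (update s r (l ++ s r)) := by
  induction l with
  | nil => simpa [pushList] using runs_skip f _ _
  | cons b l ih => exact (ih.seq (runs_push f r b _)).congr (by simp) (by simp)

/-- Write the entries of a list to the registers from number `j` on. -/
def pushBlock : ℕ → List (List Bool) → Frag
  | _, [] => skip
  | j, l :: ls => (pushList (j + 1) l).seq (pushBlock (j + 1) ls)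

theorem runs_pushBlock (f : Oracle) (a : List (List Bool)) {j : ℕ} {L : List (List Bool)}
    (hj : j = L.length) : (pushBlock j a).Runs f (total a) (store L) (store (L ++ a)) := by
  induction a generalizing L j with
  | nil => simpa [pushBlock] using runs_skip f _ _
  | cons l ls ih =>
    have h1 := runs_pushList f (j + 1) l (store L)
    rw [store_end hj, List.append_nil, update_store_end hj] at h1
    exact (h1.seq (ih (j := j + 1) (L := L ++ [l]) (by simp [hj]))).congr (by simp) (by simp)

end Frag

/-! ### Polynomial-time functions -/

/-- A representation of the elements of `α` by a fixed number of registers. -/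
class Enc (α : Type) where
  /-- the number of registers -/
  width : ℕ
  /-- the contents of the registers -/
  enc : α → List (List Bool)
  length_enc : ∀ a, (enc a).length = width


attribute [simp] Enc.length_enc

end Complexity

namespace Complexity

open Function Polynomial Frag

open Enc (width enc)

/-- The total length of the registers that represent `a`. -/
def size {α : Type} [Enc α] (a : α) : ℕ := total (enc a)

instance : Enc (List Bool) := ⟨1, fun l => [l], fun _ => rfl⟩

/-- Numbers are represented in unary. -/
instance : Enc ℕ := ⟨1, fun n => [List.replicate n true], fun _ => rfl⟩

instance : Enc Bool := ⟨1, fun b => [[b]], fun _ => rfl⟩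

instance {α β : Type} [Enc α] [Enc β] : Enc (α × β) :=
  ⟨width α + width β, fun a => enc a.1 ++ enc a.2, by simp⟩

@[simp] theorem size_list (l : List Bool) : size l = l.length := by simp [size, enc]

@[simp] theorem size_nat (n : ℕ) : size n = n := by simp [size, enc]

@[simp] theorem size_bool (b : Bool) : size b = 1 := by simp [size, enc]

@[simp] theorem size_prod {α β : Type} [Enc α] [Enc β] (a : α × β) :
    size a = size a.1 + size a.2 := by
  simp [size, enc]

theorem enc_prod {α β : Type} [Enc α] [Enc β] (a : α × β) : enc a = enc a.1 ++ enc a.2 := rfl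

theorem length_block {α : Type} [Enc α] {L₁ L₂ : List (List Bool)} {i j : ℕ} (a : α)
    (h₁ : L₁.length = i) (h₂ : L₂.length = j) :
    i + width α + j = (L₁ ++ enc a ++ L₂).length := by
  simp [h₁, h₂]; omega

theorem eval_mono (p : ℕ[X]) : Monotone fun n => p.eval n := by
  intro m n h
  simp only [Polynomial.eval_eq_sum, Polynomial.sum]
  gcongr

variable {α β γ δ : Type} [Enc α] [Enc β] [Enc γ] [Enc δ] {Ω : Set Oracle}

/-- `F f`, for the oracles `f` in `Ω`, is computed in polynomial time by one fragment with oracle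
`f`. The arguments are in a block of registers; the value is written to a block of new registers
on top, everything else being left as it was. The fragment may depend on the numbers `i` and `j` of
other registers below and above the arguments, but the time bound may not. -/
def PolyTimeO (Ω : Set Oracle) (F : Oracle → α → β) : Prop :=
  ∃ p : ℕ[X], (∀ f ∈ Ω, ∀ a, size (F f a) ≤ p.eval (size a)) ∧
    ∀ i j : ℕ, ∃ A : Frag, ∀ f ∈ Ω, ∀ (L₁ L₂ : List (List Bool)) (a : α),
      L₁.length = i → L₂.length = j →
        A.Runs f (p.eval (size a)) (store (L₁ ++ enc a ++ L₂))
          (store (L₁ ++ enc a ++ L₂ ++ enc (F f a)))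

namespace PolyTimeO

theorem mono {Ω' : Set Oracle} {F : Oracle → α → β} (h : PolyTimeO Ω F) (hΩ : Ω' ⊆ Ω) :
    PolyTimeO Ω' F := by
  obtain ⟨p, hp, hA⟩ := h
  refine ⟨p, fun f hf => hp f (hΩ hf), fun i j => ?_⟩
  obtain ⟨A, h⟩ := hA i j
  exact ⟨A, fun f hf => h f (hΩ hf)⟩

theorem fst : PolyTimeO Ω fun _ (a : α × β) => a.1 := by
  refine ⟨C 5 * X + C (2 * width α), fun f _ a => by simp; omega, fun i j =>
    ⟨copyBlock i (i + width α + (width β + j)) (width α), ?_⟩⟩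
  intro f _ L₁ L₂ a h₁ h₂
  have := runs_copyBlock f (enc a.1) (i := i) (j := i + width α + (width β + j)) (L₁ := L₁)
    (L₂ := enc a.2 ++ L₂) h₁.symm (by simp [h₁, h₂]; omega)
  rw [Enc.length_enc] at this
  have := this.congr (t' := (C 5 * X + C (2 * width α)).eval (size a))
    (by simp [size, enc_prod]) rfl
  simpa [enc_prod] using this

theorem snd : PolyTimeO Ω fun _ (a : α × β) => a.2 := by
  refine ⟨C 5 * X + C (2 * width β), fun f _ a => by simp; omega, fun i j =>
    ⟨copyBlock (i + width α) (i + width α + (width β + j)) (width β), ?_⟩⟩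
  intro f _ L₁ L₂ a h₁ h₂
  have := runs_copyBlock f (enc a.2) (i := i + width α) (j := i + width α + (width β + j))
    (L₁ := L₁ ++ enc a.1) (L₂ := L₂) (by simp [h₁]) (by simp [h₁, h₂]; omega)
  rw [Enc.length_enc] at this
  have := this.congr (t' := (C 5 * X + C (2 * width β)).eval (size a))
    (by simp [size, enc_prod]) rfl
  simpa [enc_prod] using this

theorem id : PolyTimeO Ω fun _ (a : α) => a := by
  refine ⟨C 5 * X + C (2 * width α), fun f _ a => by simp; omega, fun i j =>
    ⟨copyBlock i (i + width α + j) (width α), ?_⟩⟩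
  intro f _ L₁ L₂ a h₁ h₂
  have := runs_copyBlock f (enc a) (i := i) (j := i + width α + j) (L₁ := L₁)
    (L₂ := L₂) h₁.symm (length_block a h₁ h₂)
  rw [Enc.length_enc] at this
  exact this.congr (by simp [size]) rfl

theorem const (b : β) : PolyTimeO Ω fun _ (_ : α) => b := by
  refine ⟨C (size b), fun f _ a => by simp, fun i j =>
    ⟨pushBlock (i + width α + j) (enc b), ?_⟩⟩
  intro f _ L₁ L₂ a h₁ h₂
  exact (runs_pushBlock f (enc b) (length_block a h₁ h₂)).congr (by simp [size]) rfl

theorem pair {F : Oracle → α → β} {G : Oracle → α → γ} (hF : PolyTimeO Ω F)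
    (hG : PolyTimeO Ω G) : PolyTimeO Ω fun f a => (F f a, G f a) := by
  obtain ⟨p, hp, hA⟩ := hF
  obtain ⟨q, hq, hB⟩ := hG
  refine ⟨p + q, fun f hf a => ?_, fun i j => ?_⟩
  · have := hp f hf a
    have := hq f hf a
    simp; omega
  · obtain ⟨A, hA⟩ := hA i j
    obtain ⟨B, hB⟩ := hB i (j + width β)
    refine ⟨A.seq B, fun f hf L₁ L₂ a h₁ h₂ => ?_⟩
    have h1 := hA f hf L₁ L₂ a h₁ h₂
    have h2 := hB f hf L₁ (L₂ ++ enc (F f a)) a h₁ (by simp [h₂])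
    simp only [← List.append_assoc] at h2
    exact (h1.seq h2).congr (by simp) (by simp [enc])

theorem comp {F : Oracle → α → β} {G : Oracle → β → γ} (hG : PolyTimeO Ω G)
    (hF : PolyTimeO Ω F) : PolyTimeO Ω fun f a => G f (F f a) := by
  obtain ⟨p, hp, hA⟩ := hF
  obtain ⟨q, hq, hB⟩ := hG
  have hsize (f) (hf : f ∈ Ω) (a) : size (G f (F f a)) ≤ q.eval (p.eval (size a)) :=
    (hq f hf _).trans (eval_mono q (hp f hf a))
  -- The last summand is the time to delete the intermediate value `F f a`.
  refine ⟨p + q.comp p + C (width β) * (C 5 * (p + q.comp p) + C (2 * (width β + width γ) + 1)),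
    fun f hf a => ?_, fun i j => ?_⟩
  · have := hsize f hf a
    simp only [eval_add, eval_mul, eval_comp]; omega
  · obtain ⟨A, hA⟩ := hA i j
    obtain ⟨B, hB⟩ := hB (i + width α + j) 0
    refine ⟨(A.seq B).seq (squeeze (i + width α + j) (width β) (width γ)),
      fun f hf L₁ L₂ a h₁ h₂ => ?_⟩
    have h1 := hA f hf L₁ L₂ a h₁ h₂
    have h2 := hB f hf (L₁ ++ enc a ++ L₂) [] (F f a) (length_block a h₁ h₂).symm rfl
    have h3 := runs_squeeze f (enc (F f a)) (enc (G f (F f a))) (i := i + width α + j)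
      (L := L₁ ++ enc a ++ L₂) (length_block a h₁ h₂)
    rw [Enc.length_enc, Enc.length_enc] at h3
    simp only [List.append_nil] at h2
    refine ((h1.seq h2).seq h3).congr ?_ rfl
    have e1 := hp f hf a
    have e2 := hsize f hf a
    have e3 := eval_mono q (hp f hf a)
    simp only [eval_add, eval_mul, eval_comp, eval_C]
    change _ + _ + width β * (5 * (size (F f a) + size (G f (F f a))) + _ + 1) ≤ _
    have e4 := Nat.mul_le_mul_left (width β) (show 5 * (size (F f a) + size (G f (F f a))) +
      2 * (width β + width γ) + 1 ≤ 5 * (p.eval (size a) + q.eval (p.eval (size a))) +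
      (2 * (width β + width γ) + 1) by omega)
    have e5 : q.eval (size (F f a)) ≤ q.eval (p.eval (size a)) := e3
    omega

/-- Definition by cases. -/
protected theorem cond {c : Oracle → α → Bool} {F G : Oracle → α → β} (hc : PolyTimeO Ω c)
    (hF : PolyTimeO Ω F) (hG : PolyTimeO Ω G) :
    PolyTimeO Ω fun f a => if c f a then F f a else G f a := by
  obtain ⟨r, hr, hC⟩ := hc
  obtain ⟨p, hp, hA⟩ := hF
  obtain ⟨q, hq, hB⟩ := hG
  refine ⟨r + p + q + 1, fun f hf a => ?_, fun i j => ?_⟩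
  · have := hp f hf a
    have := hq f hf a
    simp only [eval_add]
    split_ifs <;> omega
  · obtain ⟨C, hC⟩ := hC i j
    obtain ⟨A, hA⟩ := hA i j
    obtain ⟨B, hB⟩ := hB i j
    refine ⟨C.seq (branch (i + width α + j + 1) fun o => if o = some true then A else B),
      fun f hf L₁ L₂ a h₁ h₂ => ?_⟩
    have h1 := hC f hf L₁ L₂ a h₁ h₂
    have hi : i + width α + j = (L₁ ++ enc a ++ L₂).length := length_block a h₁ h₂
    refine (h1.seq (t' := p.eval (size a) + q.eval (size a) + 1) (s' := store (L₁ ++ enc a ++ L₂ ++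
      enc (if c f a = true then F f a else G f a))) ?_).congr (by simp; omega) rfl
    refine runs_branch ?_
    -- The register of the condition is empty after the branch, as the registers above the arguments
    -- are before `F` or `G` is run.
    simp only [enc, store_mid hi, update_store_mid hi]
    rw [List.head?_cons, List.tail_cons, store_append_nil]
    cases hca : c f a
    · simpa using (hB f hf L₁ L₂ a h₁ h₂).mono (by omega)
    · simpa using (hA f hf L₁ L₂ a h₁ h₂).mono (by omega)

/-- Recursion along a list of bits, where the intermediate values are of polynomial size. -/
theorem foldl {c : Oracle → α → List Bool} {F : Oracle → α → β} {G : Bool → Oracle → β → β}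
    (hc : PolyTimeO Ω c) (hF : PolyTimeO Ω F) (hG : ∀ b, PolyTimeO Ω (G b))
    (hsize : ∃ q : ℕ[X], ∀ f ∈ Ω, ∀ a l, l <+: c f a →
      size (l.foldl (fun x b => G b f x) (F f a)) ≤ q.eval (size a)) :
    PolyTimeO Ω fun f a => (c f a).foldl (fun x b => G b f x) (F f a) := by
  obtain ⟨q, hq⟩ := hsize
  obtain ⟨r, hr, hC⟩ := hc
  obtain ⟨p, hp, hA⟩ := hF
  choose g hg hB using hG
  -- Register `i + width α + j` holds the rest of the list, and the registers above it the current
  -- value `x`. Each pass writes `G b f x` on top, and then deletes `x`.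
  refine ⟨q + r + p + (r * ((g true + g false).comp q + C (width β) * (C 10 * q +
    C (4 * width β) + 1) + 1) + 1) + (C 5 * q + C (2 * (1 + width β) + 1)),
    fun f hf a => ?_, fun i j => ?_⟩
  · have := hq f hf a _ (List.prefix_refl _)
    simp only [eval_add]
    omega
  · obtain ⟨C, hC⟩ := hC i j
    obtain ⟨A, hA⟩ := hA i (j + 1)
    choose B hB using fun b => hB b (i + width α + j + 1) 0
    refine ⟨((C.seq A).seq (loop (i + width α + j + 1) fun b => (B b).seq
      (squeeze (i + width α + j + 1) (width β) (width β)))).seq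
      (squeeze (i + width α + j) 1 (width β)), fun f hf L₁ L₂ a h₁ h₂ => ?_⟩
    have h1 := hC f hf L₁ L₂ a h₁ h₂
    have h2 := hA f hf L₁ (L₂ ++ [c f a]) a h₁ (by simp [h₂])
    have hi : i + width α + j = (L₁ ++ enc a ++ L₂).length := length_block a h₁ h₂
    simp only [← List.append_assoc] at h2
    have hQ := hq f hf a
    have hsq (L x y : List (List Bool)) (hL : L.length = i + width α + j + 1)
        (hx : x.length = width β) (hy : y.length = width β) :=
      hx ▸ hy ▸ runs_squeeze f x y (L := L) hL.symm
    generalize L₁ ++ enc a ++ L₂ = M at *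
    generalize hQe : q.eval (size a) = Q at *
    have h3 : ∀ (l : List Bool) (x : β),
        (∀ l', l' <+: l → size (l'.foldl (fun x b => G b f x) x) ≤ Q) →
        (loop (i + width α + j + 1) fun b => (B b).seq
          (squeeze (i + width α + j + 1) (width β) (width β))).Runs f
          (l.length * ((g true + g false).eval Q + width β * (10 * Q + 4 * width β + 1) + 1) + 1)
          (store (M ++ l :: enc x))
          (store (M ++ [] :: enc (l.foldl (fun x b => G b f x) x))) := by
      intro l
      induction l with
      | nil => intro x _; exact (runs_loop_nil (store_mid hi)).congr (by simp) rfl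
      | cons b l ih =>
        intro x hx
        have k1 := hB b f hf (M ++ [l]) [] x (by simp [hi]) rfl
        have k2 := hsq (M ++ [l]) (enc x) (enc (G b f x)) (by simp [hi]) (by simp) (by simp)
        simp only [List.append_nil] at k1
        have k3 := ih (G b f x) fun l' hl' => hx (b :: l') (by simpa using hl')
        have k12 := k1.seq k2
        simp only [List.append_assoc, List.singleton_append] at k12
        rw [← update_store_mid (L₂ := enc x) (a := b :: l) (b := l) hi] at k12
        have k4 := runs_loop_cons (A := fun b => (B b).seq
          (squeeze (i + width α + j + 1) (width β) (width β))) (store_mid hi) k12 k3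
        refine k4.congr ?_ rfl
        have e1 : size x ≤ Q := hx [] (by simp)
        have e2 : size (G b f x) ≤ Q := by simpa using hx [b] (by simp)
        have e3 : (g b).eval (size x) ≤ (g true + g false).eval Q := by
          refine (eval_mono (g b) e1).trans ?_
          cases b <;> simp
        have e4 := Nat.mul_le_mul_left (width β) (show 5 * (size x + size (G b f x)) +
          2 * (width β + width β) + 1 ≤ 10 * Q + 4 * width β + 1 by omega)
        change _ + width β * (5 * (size x + size (G b f x)) + _ + 1) + _ + _ ≤ _
        rw [List.length_cons, Nat.add_mul]
        omega
    have h4 := h3 (c f a) (F f a) hQ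
    have h5 := runs_squeeze f [[]] (enc ((c f a).foldl (fun x b => G b f x) (F f a))) hi
    rw [Enc.length_enc, List.length_singleton] at h5
    have h6 := ((h1.seq h2).seq (by simpa [enc] using h4)).seq (by simpa using h5)
    refine h6.congr ?_ rfl
    have e1 := hQ _ (List.prefix_refl _)
    have e2 : (c f a).length ≤ r.eval (size a) := by simpa using hr f hf a
    have e3 := Nat.mul_le_mul_right ((g true + g false).eval Q + width β *
      (10 * Q + 4 * width β + 1) + 1) e2
    simp only [size] at e1
    simp only [eval_add, eval_mul, eval_comp, eval_C, eval_one, hQe] at e3 ⊢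
    omega

/-- A call of the oracle, where the answers are of polynomial length. -/
theorem oracle {F : Oracle → α → List Bool} (hF : PolyTimeO Ω F)
    (hsize : ∃ q : ℕ[X], ∀ f ∈ Ω, ∀ a, (f (F f a)).length ≤ q.eval (size a)) :
    PolyTimeO Ω fun f a => f (F f a) := by
  obtain ⟨q, hq⟩ := hsize
  obtain ⟨p, hp, hA⟩ := hF
  -- The query is moved to the oracle stack and the answer back, by way of the next free register,
  -- as each move reverses a stack twice.
  refine ⟨p + C 4 * p + C 4 * q + 5 + q, fun f hf a => ?_, fun i j => ?_⟩
  · have := hq f hf a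
    simp only [eval_add, size_list]; omega
  · obtain ⟨A, hA⟩ := hA i j
    refine ⟨((A.seq (move (i + width α + j + 2) (i + width α + j + 1) 0)).seq query).seq
      (move (i + width α + j + 2) 0 (i + width α + j + 1)), fun f hf L₁ L₂ a h₁ h₂ => ?_⟩
    have h1 := hA f hf L₁ L₂ a h₁ h₂
    have hi : i + width α + j = (L₁ ++ enc a ++ L₂).length := length_block a h₁ h₂
    generalize L₁ ++ enc a ++ L₂ = M at *
    change A.Runs _ _ _ (store (M ++ [F f a])) at h1
    have hs : store (M ++ [F f a]) (i + width α + j + 1) = F f a := store_mid hi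
    have ht : store (M ++ [F f a]) (i + width α + j + 2) = [] := store_end (by simp [hi])
    have h2 := runs_move f (t := i + width α + j + 2) (i := i + width α + j + 1) (j := 0)
      (by omega) (by omega) (by omega) _ ht rfl
    rw [hs, update_store_mid hi, store_append_nil] at h2
    have h3 := runs_query f (update (store M) 0 (F f a))
    have h4 := runs_move f (t := i + width α + j + 2) (i := 0) (j := i + width α + j + 1)
      (by omega) (by omega) (by omega) (update (store M) 0 (f (F f a)))
      (by rw [update_of_ne (by omega), ← store_append_nil]; exact store_end (by simp [hi]))
      (by rw [update_of_ne (by omega)]; exact store_end hi)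
    simp only [update_self, update_idem] at h3 h4
    have e0 : update (store M) 0 [] = store M := update_eq_self 0 (store M)
    rw [e0, update_store_end hi] at h4
    refine (((h1.seq h2).seq h3).seq h4).congr ?_ rfl
    have e1 := hp f hf a
    have e2 := hq f hf a
    simp only [size_list] at e1
    simp only [eval_add, eval_mul, eval_C, eval_ofNat]
    omega

/-- Functions computed by changing the register on top. -/
theorem of_register {h : α → β} {u : α → List Bool} {g : List Bool → List Bool}
    (hu : ∀ a, enc a = [u a]) (hg : ∀ a, enc (h a) = [g (u a)]) (B : ℕ → Frag) (p : ℕ[X])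
    (hp : ∀ l, (g l).length ≤ p.eval l.length)
    (hB : ∀ f k s, (B k).Runs f (p.eval (s k).length) s (update s k (g (s k)))) :
    PolyTimeO Ω fun _ a => h a := by
  obtain ⟨r, hr, hA⟩ := PolyTimeO.id (α := α) (Ω := Ω)
  refine ⟨r + p, fun f hf a => ?_, fun i j => ?_⟩
  · have := hp (u a)
    simp only [eval_add, size, hg, hu, total_cons, total_nil, add_zero]; omega
  · obtain ⟨A, hA⟩ := hA i j
    refine ⟨A.seq (B (i + width α + j + 1)), fun f hf L₁ L₂ a h₁ h₂ => ?_⟩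
    have h1 := hA f hf L₁ L₂ a h₁ h₂
    have hi : i + width α + j = (L₁ ++ enc a ++ L₂).length := length_block a h₁ h₂
    have hsize : size a = (u a).length := by simp [size, hu]
    rw [eval_add, hg a]
    generalize L₁ ++ enc a ++ L₂ = M at *
    rw [hu a] at h1
    have h2 := hB f (i + width α + j + 1) (store (M ++ [u a]))
    rw [store_mid hi, update_store_mid hi] at h2
    exact (h1.seq h2).congr (by rw [hsize]) rfl

end PolyTimeO

end Complexity

namespace Complexity

open Function Polynomial Frag

/-! ### From fragments to machines -/

/-- The number of the stack that an instruction refers to. -/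
def Instr.reg {Q : Type} : Instr ℕ Q → ℕ
  | .push k _ _ => k
  | .pop k _ => k
  | .query _ => 0
  | .halt _ => 0

/-- The machine that runs `A` on the input in register `1`, and then accepts if the top of
register `2` is `true`. It has the stacks `0, …, N + 2`. -/
def Frag.toMachine (A : Frag) (N : ℕ) : Machine where
  K := Fin (N + 3)
  Q := Option A.Q ⊕ Bool
  inp := 1
  orc := 0
  start := .inl A.start
  instr
    | .inl (some q) => (A.instr q).map (Fin.ofNat (N + 3)) .inl
    | .inl none => .pop 2 fun o => .inr (o.getD false)
    | .inr b => .halt b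

namespace Frag

/-- The machine simulates one step of the fragment. It holds the stacks with number at most `N + 2`
only, which is enough if the instruction refers to one of them. -/
theorem step_toMachine {A : Frag} {N : ℕ} {f : Oracle} {q : A.Q} {o : Option A.Q}
    {s s' : Store} (hN : (A.instr q).reg < N + 3) (h : (A.instr q).exec f s = some (o, s')) :
    (A.toMachine N).step f ⟨.inl (some q), fun k : Fin (N + 3) => s k⟩ =
      ⟨.inl o, fun k : Fin (N + 3) => s' k⟩ := by
  have hupd (k : ℕ) (hk : k < N + 3) (l : List Bool) :
      update (fun k : Fin (N + 3) => s k) (Fin.ofNat (N + 3) k) l =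
        fun k' : Fin (N + 3) => update s k l k' := by
    have h0 : Fin.ofNat (N + 3) k = ⟨k, hk⟩ := Fin.ext (Nat.mod_eq_of_lt hk)
    rw [h0]
    funext k'
    simp only [update_apply, Fin.ext_iff]
  unfold Machine.step
  simp only [toMachine]
  cases hq : A.instr q with
  | push k b q' =>
    rw [hq] at hN h
    obtain ⟨rfl, rfl⟩ : q' = o ∧ _ = s' := by simpa [Instr.exec] using h
    simp only [Instr.map]
    congr 1
    rw [← hupd k hN]
    simp [Nat.mod_eq_of_lt (show k < N + 3 from hN)]
    rfl
  | pop k next =>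
    rw [hq] at hN h
    obtain ⟨rfl, rfl⟩ : next (s k).head? = o ∧ _ = s' := by simpa [Instr.exec] using h
    simp only [Instr.map]
    rw [← hupd k hN]
    simp [Nat.mod_eq_of_lt (show k < N + 3 from hN)]
    rfl
  | query q' =>
    rw [hq] at hN h
    obtain ⟨rfl, rfl⟩ : q' = o ∧ _ = s' := by simpa [Instr.exec] using h
    simp only [Instr.map]
    congr 1
    rw [← hupd 0 hN]
    simp
    rfl
  | halt b => simp [hq, Instr.exec] at h

theorem Reach.toMachine {A : Frag} {N : ℕ} {f : Oracle} (hN : ∀ q, (A.instr q).reg < N + 3)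
    {t : ℕ} {o o' : Option A.Q} {s s' : Store} (h : A.Reach f t o s o' s') :
    ∃ u ≤ t, ((A.toMachine N).step f)^[u] ⟨.inl o, fun k : Fin (N + 3) => s k⟩ =
      ⟨.inl o', fun k : Fin (N + 3) => s' k⟩ := by
  induction h with
  | refl => exact ⟨0, by omega, rfl⟩
  | @step t q _ _ _ _ _ h1 _ ih =>
    obtain ⟨u, hu, h⟩ := ih
    refine ⟨u + 1, by omega, ?_⟩
    rw [iterate_succ_apply, step_toMachine (hN q) h1, h]

end Frag

theorem Machine.iterate_step_of_halt {M : Machine} {f : Oracle} {c : M.Cfg} {b : Bool}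
    (h : M.instr c.state = .halt b) (t : ℕ) : (M.step f)^[t] c = c := by
  have : M.step f c = c := by simp only [step, h]
  exact iterate_fixed this t

/-- A predicate computed in polynomial time with oracles from `Ω` is decided by one machine. -/
theorem PolyTimeO.exists_machine {Ω : Set Oracle} {F : Oracle → List Bool → Bool}
    (hF : PolyTimeO Ω F) : ∃ (M : Machine) (p : ℕ[X]), ∀ f ∈ Ω, ∀ L : Language Bool,
      (∀ x, F f x = true ↔ x ∈ L) → M.DecidesInTime f L p := by
  obtain ⟨p, -, hA⟩ := hF
  obtain ⟨A, hA⟩ := hA 0 0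
  obtain ⟨N, hN⟩ : ∃ N, ∀ q, (A.instr q).reg < N + 3 :=
    ⟨Finset.univ.sup fun q => (A.instr q).reg, fun q => by
      have := Finset.le_sup (f := fun q => (A.instr q).reg) (Finset.mem_univ q)
      omega⟩
  refine ⟨A.toMachine N, p + 1, fun f hf L hL x => ⟨F f x, ?_, hL x⟩⟩
  have h1 := hA f hf [] [] x rfl rfl
  obtain ⟨u, hu, h2⟩ := Reach.toMachine hN h1
  have hinit : (A.toMachine N).init x =
      ⟨.inl A.start, fun k : Fin (N + 3) => store ([] ++ Enc.enc x ++ []) k⟩ := by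
    unfold Machine.init
    congr 1
    refine funext fun (k : Fin (N + 3)) => ?_
    change update (fun _ => []) (1 : Fin (N + 3)) x k = _
    rw [update_apply]
    rcases k with ⟨_ | _ | k, hk⟩
    · simp [store]
    · simp [store, Enc.enc]
    · simp [store, Enc.enc, Fin.ext_iff]
  rw [size_list] at hu
  obtain ⟨v, hv⟩ : ∃ v, (p + 1).eval x.length = v + (u + 1) :=
    ⟨p.eval x.length - u, by simp; omega⟩
  unfold Machine.HaltsWithin
  rw [hv, iterate_add_apply, iterate_succ_apply', hinit, h2]
  have h3 : ((A.toMachine N).step f ⟨.inl none, fun k : Fin (N + 3) =>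
      store ([] ++ Enc.enc x ++ [] ++ Enc.enc (F f x)) k⟩).state = .inr (F f x) := by
    simp only [Machine.step, toMachine]
    congr 1
  rw [Machine.iterate_step_of_halt (b := F f x) (by rw [h3]; rfl), h3]
  rfl

end Complexity

namespace Complexity

open Function Polynomial Frag

/-! ### A library of polynomial-time functions -/

variable {α β γ : Type} [Enc α] [Enc β] [Enc γ]

/-- The function `F` is computed in polynomial time, by a fragment that works with any oracle. -/
def PolyTime (F : α → β) : Prop := PolyTimeO Set.univ fun _ => F

/-- The function `h` is bounded by a polynomial in the size of its argument. -/
def PolyBdd (h : α → ℕ) : Prop := ∃ q : ℕ[X], ∀ a, h a ≤ q.eval (size a)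

namespace PolyBdd

theorem const (n : ℕ) : PolyBdd fun _ : α => n := ⟨C n, fun a => by simp⟩

theorem size : PolyBdd fun a : α => size a := ⟨X, fun a => by simp⟩

theorem add {h h' : α → ℕ} (hh : PolyBdd h) (hh' : PolyBdd h') : PolyBdd fun a => h a + h' a := by
  obtain ⟨q, hq⟩ := hh
  obtain ⟨q', hq'⟩ := hh'
  exact ⟨q + q', fun a => by simpa using Nat.add_le_add (hq a) (hq' a)⟩

theorem mul {h h' : α → ℕ} (hh : PolyBdd h) (hh' : PolyBdd h') : PolyBdd fun a => h a * h' a := by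
  obtain ⟨q, hq⟩ := hh
  obtain ⟨q', hq'⟩ := hh'
  exact ⟨q * q', fun a => by simpa using Nat.mul_le_mul (hq a) (hq' a)⟩

theorem eval {h : α → ℕ} (hh : PolyBdd h) (p : ℕ[X]) : PolyBdd fun a => p.eval (h a) := by
  obtain ⟨q, hq⟩ := hh
  exact ⟨p.comp q, fun a => by simpa using eval_mono p (hq a)⟩

end PolyBdd

namespace PolyTime

theorem with_oracle {F : α → β} (hF : PolyTime F) (Ω : Set Oracle) : PolyTimeO Ω fun _ => F :=
  PolyTimeO.mono hF (Set.subset_univ Ω)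

theorem polyBdd {F : α → β} (hF : PolyTime F) : PolyBdd fun a => size (F a) := by
  obtain ⟨p, hp, -⟩ := hF
  exact ⟨p, fun a => hp id trivial a⟩

theorem polyBdd_nat {n : α → ℕ} (hn : PolyTime n) : PolyBdd n := by simpa using hn.polyBdd

theorem congr {F G : α → β} (hF : PolyTime F) (h : ∀ a, F a = G a) : PolyTime G :=
  funext h ▸ hF

protected theorem id : PolyTime fun a : α => a := PolyTimeO.id

theorem const (b : β) : PolyTime fun _ : α => b := PolyTimeO.const b

theorem comp {G : β → γ} {F : α → β} (hG : PolyTime G) (hF : PolyTime F) :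
    PolyTime fun a => G (F a) := PolyTimeO.comp hG hF

theorem pair {F : α → β} {G : α → γ} (hF : PolyTime F) (hG : PolyTime G) :
    PolyTime fun a => (F a, G a) := PolyTimeO.pair hF hG

theorem fst {F : α → β × γ} (hF : PolyTime F) : PolyTime fun a => (F a).1 :=
  comp (G := Prod.fst) PolyTimeO.fst hF

theorem snd {F : α → β × γ} (hF : PolyTime F) : PolyTime fun a => (F a).2 :=
  comp (G := Prod.snd) PolyTimeO.snd hF

theorem cond {c : α → Bool} {F G : α → β} (hc : PolyTime c) (hF : PolyTime F) (hG : PolyTime G) :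
    PolyTime fun a => if c a then F a else G a := PolyTimeO.cond hc hF hG

theorem foldl {c : α → List Bool} {F : α → β} {G : Bool → β → β} (hc : PolyTime c)
    (hF : PolyTime F) (hG : ∀ b, PolyTime (G b)) {B : α → ℕ} (hB : PolyBdd B)
    (hsize : ∀ a l, l <+: c a → size (l.foldl (fun x b => G b x) (F a)) ≤ B a) :
    PolyTime fun a => (c a).foldl (fun x b => G b x) (F a) := by
  obtain ⟨q, hq⟩ := hB
  exact PolyTimeO.foldl (G := fun b _ => G b) hc hF hG
    ⟨q, fun f _ a l hl => (hsize a l hl).trans (hq a)⟩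

/-! #### Operations on one register -/

theorem cons (b : Bool) {l : α → List Bool} (hl : PolyTime l) : PolyTime fun a => b :: l a :=
  comp (G := fun l => b :: l) (PolyTimeO.of_register (u := id) (g := fun l => b :: l)
    (fun _ => rfl) (fun _ => rfl) (fun k => push k b) (X + 1) (fun l => by simp)
    (fun f k s => (runs_push f k b s).mono (by simp))) hl

theorem tail {l : α → List Bool} (hl : PolyTime l) : PolyTime fun a => (l a).tail :=
  comp (G := List.tail) (PolyTimeO.of_register (u := id) (g := List.tail)
    (fun _ => rfl) (fun _ => rfl) pop (X + 1) (fun l => by simp; omega)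
    (fun f k s => (runs_pop f k s).mono (by simp))) hl

/-- Replacing a register by a bit that depends on its top. -/
theorem runs_head (f : Oracle) (h : Option Bool → Bool) (k : ℕ) (s : Store) :
    (branch k fun o => (clear k).seq (push k (h o))).Runs f ((X + 3 : ℕ[X]).eval (s k).length) s
      (update s k [h (s k).head?]) :=
  (runs_branch ((runs_clear f k _).seq (runs_push f k _ _))).congr (by simp; omega) (by simp)

theorem head (h : Option Bool → Bool) {l : α → List Bool} (hl : PolyTime l) :
    PolyTime fun a => h (l a).head? :=
  comp (G := fun l : List Bool => h l.head?) (PolyTimeO.of_register (u := id)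
    (g := fun l => [h l.head?]) (fun _ => rfl) (fun _ => rfl) _ (X + 3) (fun l => by simp)
    (fun f k s => runs_head f h k s)) hl

theorem isEmpty {l : α → List Bool} (hl : PolyTime l) : PolyTime fun a => (l a).isEmpty :=
  (head Option.isNone hl).congr fun a => by cases l a <;> rfl

theorem succ {n : α → ℕ} (hn : PolyTime n) : PolyTime fun a => n a + 1 :=
  comp (G := fun n : ℕ => n + 1) (PolyTimeO.of_register (u := fun n => List.replicate n true)
    (g := fun l => true :: l) (fun _ => rfl) (fun _ => rfl) (fun k => push k true) (X + 1)
    (fun l => by simp) (fun f k s => (runs_push f k true s).mono (by simp))) hn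

theorem pred {n : α → ℕ} (hn : PolyTime n) : PolyTime fun a => n a - 1 :=
  comp (G := fun n : ℕ => n - 1) (PolyTimeO.of_register (u := fun n => List.replicate n true)
    (g := List.tail) (fun _ => rfl) (fun n => by simp [Enc.enc]) pop (X + 1)
    (fun l => by simp; omega) (fun f k s => (runs_pop f k s).mono (by simp))) hn

theorem isZero {n : α → ℕ} (hn : PolyTime n) : PolyTime fun a => decide (n a = 0) :=
  comp (G := fun n : ℕ => decide (n = 0)) (PolyTimeO.of_register
    (u := fun n => List.replicate n true) (g := fun l => [l.head?.isNone]) (fun _ => rfl)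
    (fun n => by cases n <;> rfl) _ (X + 3) (fun l => by simp)
    (fun f k s => runs_head f _ k s)) hn

theorem replicate {n : α → ℕ} (hn : PolyTime n) : PolyTime fun a => List.replicate (n a) true :=
  comp (G := fun n : ℕ => List.replicate n true) (PolyTimeO.of_register
    (u := fun n => List.replicate n true) (g := id) (fun _ => rfl)
    (fun n => rfl) (fun _ => skip) X (fun l => by simp)
    (fun f k s => (runs_skip f _ s).congr le_rfl (by simp))) hn

theorem singleton {b : α → Bool} (hb : PolyTime b) : PolyTime fun a => [b a] :=
  comp (G := fun b : Bool => [b]) (PolyTimeO.of_register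
    (u := fun b => [b]) (g := id) (fun _ => rfl)
    (fun n => rfl) (fun _ => skip) X (fun l => by simp)
    (fun f k s => (runs_skip f _ s).congr le_rfl (by simp))) hb

/-! #### Booleans -/

theorem not {c : α → Bool} (hc : PolyTime c) : PolyTime fun a => !c a :=
  (cond hc (const false) (const true)).congr fun a => by cases c a <;> rfl

theorem and {c d : α → Bool} (hc : PolyTime c) (hd : PolyTime d) : PolyTime fun a => c a && d a :=
  (cond hc hd (const false)).congr fun a => by cases c a <;> rfl

theorem or {c d : α → Bool} (hc : PolyTime c) (hd : PolyTime d) : PolyTime fun a => c a || d a :=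
  (cond hc (const true) hd).congr fun a => by cases c a <;> rfl

/-! #### Numbers -/

theorem iterate {n : α → ℕ} {F : α → β} {G : β → β} (hn : PolyTime n) (hF : PolyTime F)
    (hG : PolyTime G) {B : α → ℕ} (hB : PolyBdd B)
    (hsize : ∀ a, ∀ m ≤ n a, size (G^[m] (F a)) ≤ B a) :
    PolyTime fun a => G^[n a] (F a) := by
  have key (m : ℕ) (x : β) : (List.replicate m true).foldl (fun x _ => G x) x = G^[m] x := by
    induction m generalizing x with
    | zero => rfl
    | succ m ih => rw [List.replicate_succ, List.foldl_cons, ih, iterate_succ_apply]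
  refine (foldl (replicate hn) hF (fun _ => hG) hB fun a l hl => ?_).congr fun a => key _ _
  obtain ⟨hm, hl⟩ := List.prefix_replicate_iff.1 hl
  rw [hl, key]
  exact hsize a _ hm

theorem add {m n : α → ℕ} (hm : PolyTime m) (hn : PolyTime n) : PolyTime fun a => m a + n a := by
  have key (m n : ℕ) : (· + 1)^[n] m = m + n := by simp
  refine (iterate hn hm (succ .id) (hm.polyBdd_nat.add hn.polyBdd_nat) fun a k hk => ?_).congr
    fun a => key _ _
  rw [key, size_nat]; omega

theorem sub {m n : α → ℕ} (hm : PolyTime m) (hn : PolyTime n) : PolyTime fun a => m a - n a := by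
  have key (m n : ℕ) : (· - 1)^[n] m = m - n := by
    induction n with
    | zero => rfl
    | succ n ih => rw [iterate_succ_apply', ih]; omega
  refine (iterate hn hm (pred .id) hm.polyBdd_nat fun a k hk => ?_).congr fun a => key _ _
  rw [key, size_nat]; omega

theorem mul {m n : α → ℕ} (hm : PolyTime m) (hn : PolyTime n) : PolyTime fun a => m a * n a := by
  have key (m n : ℕ) : (fun x : ℕ × ℕ => (x.1 + x.2, x.2))^[n] (0, m) = (m * n, m) := by
    induction n with
    | zero => rfl
    | succ n ih => rw [iterate_succ_apply', ih]; rfl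
  refine (iterate hn ((const 0).pair hm)
    (((fst .id).add (snd .id)).pair (snd .id))
    ((hm.polyBdd_nat.mul hn.polyBdd_nat).add hm.polyBdd_nat) fun a k hk => ?_).fst.congr
    fun a => by rw [key]
  rw [key, size_prod, size_nat, size_nat]
  have := Nat.mul_le_mul_left (m a) hk
  omega

theorem eval {n : α → ℕ} (hn : PolyTime n) (p : ℕ[X]) : PolyTime fun a => p.eval (n a) := by
  induction p using Polynomial.induction_on' with
  | add p q hp hq => exact (hp.add hq).congr fun a => by simp
  | monomial k c =>
    simp only [eval_monomial]
    refine (const c).mul ?_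
    induction k with
    | zero => exact (const 1).congr fun a => by simp
    | succ k ih => exact (ih.mul hn).congr fun a => by rw [pow_succ]

theorem le {m n : α → ℕ} (hm : PolyTime m) (hn : PolyTime n) :
    PolyTime fun a => decide (m a ≤ n a) :=
  (isZero (hm.sub hn)).congr fun a => by simp [Nat.sub_eq_zero_iff_le]

theorem lt {m n : α → ℕ} (hm : PolyTime m) (hn : PolyTime n) :
    PolyTime fun a => decide (m a < n a) :=
  (le hm.succ hn).congr fun a => by simp

theorem eq {m n : α → ℕ} (hm : PolyTime m) (hn : PolyTime n) :
    PolyTime fun a => decide (m a = n a) :=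
  ((le hm hn).and (le hn hm)).congr fun a => by
    rw [← Bool.decide_and, decide_eq_decide]; omega

theorem divMod {m n : α → ℕ} (hm : PolyTime m) (hn : PolyTime n) (h0 : ∀ a, 0 < n a) :
    PolyTime fun a => (m a / n a, m a % n a) := by
  have key (m n : ℕ) (h : 0 < n) : (fun x : (ℕ × ℕ) × ℕ => if x.1.2 + 1 = x.2 then
      ((x.1.1 + 1, 0), x.2) else ((x.1.1, x.1.2 + 1), x.2))^[m] ((0, 0), n) =
      ((m / n, m % n), n) := by
    have aux : ∃ q r, q * n + r = m ∧ r < n ∧ (fun x : (ℕ × ℕ) × ℕ => if x.1.2 + 1 = x.2 then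
      ((x.1.1 + 1, 0), x.2) else ((x.1.1, x.1.2 + 1), x.2))^[m] ((0, 0), n) = ((q, r), n) := by
      induction m with
      | zero => exact ⟨0, 0, by simp, h, rfl⟩
      | succ m ih =>
        obtain ⟨q, r, h1, h2, h3⟩ := ih
        rw [iterate_succ_apply', h3]
        by_cases h4 : r + 1 = n
        · exact ⟨q + 1, 0, by rw [Nat.add_mul]; omega, h, by simp [h4]⟩
        · exact ⟨q, r + 1, by omega, by omega, by simp [h4]⟩
    obtain ⟨q, r, rfl, h2, h3⟩ := aux
    rw [h3, Nat.mul_comm, Nat.mul_add_div h, Nat.mul_add_mod, Nat.div_eq_of_lt h2,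
      Nat.mod_eq_of_lt h2, add_zero]
  have hG : PolyTime fun x : (ℕ × ℕ) × ℕ => if x.1.2 + 1 = x.2 then
      ((x.1.1 + 1, 0), x.2) else ((x.1.1, x.1.2 + 1), x.2) :=
    (cond (eq (succ (snd (fst .id))) (snd .id))
      (((succ (fst (fst .id))).pair (const 0)).pair (snd .id))
      (((fst (fst .id)).pair (succ (snd (fst .id)))).pair (snd .id))).congr fun a => by simp
  refine (iterate hm (((const 0).pair (const 0)).pair hn) hG
    ((hm.polyBdd_nat.add hn.polyBdd_nat).add hn.polyBdd_nat) fun a k hk => ?_).fst.congr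
    fun a => by rw [key _ _ (h0 a)]
  rw [key _ _ (h0 a)]
  simp only [size_prod, size_nat]
  have h1 := Nat.div_le_self k (n a)
  have h2 := Nat.mod_lt k (h0 a)
  omega

/-! #### Lists of bits -/

theorem reverse {l : α → List Bool} (hl : PolyTime l) : PolyTime fun a => (l a).reverse := by
  refine (foldl (G := fun b x => b :: x) hl (const []) (fun b => cons b .id) hl.polyBdd
    fun a l hl => ?_).congr fun a => by simp
  simpa using hl.length_le

theorem append {l l' : α → List Bool} (hl : PolyTime l) (hl' : PolyTime l') :
    PolyTime fun a => l a ++ l' a := by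
  refine (foldl (G := fun b x => b :: x) hl.reverse hl' (fun b => cons b .id)
    (hl.polyBdd.add hl'.polyBdd) fun a l h => ?_).congr fun a => by simp
  have := h.length_le
  simp at this ⊢
  omega

theorem drop {l : α → List Bool} {n : α → ℕ} (hl : PolyTime l) (hn : PolyTime n) :
    PolyTime fun a => (l a).drop (n a) := by
  have key (l : List Bool) (n : ℕ) : List.tail^[n] l = l.drop n := by
    induction n with
    | zero => rfl
    | succ n ih => rw [iterate_succ_apply', ih, List.tail_drop]
  refine (iterate hn hl (tail .id) hl.polyBdd fun a k hk => ?_).congr fun a => key _ _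
  rw [key]; simp

theorem getD {l : α → List Bool} {n : α → ℕ} (hl : PolyTime l) (hn : PolyTime n) :
    PolyTime fun a => (l a).getD (n a) false :=
  (head (·.getD false) (drop hl hn)).congr fun a => by simp

theorem length {l : α → List Bool} (hl : PolyTime l) : PolyTime fun a => (l a).length := by
  have key (l : List Bool) (n : ℕ) : l.foldl (fun x (_ : Bool) => x + 1) n = n + l.length := by
    induction l generalizing n with
    | nil => rfl
    | cons b l ih => rw [List.foldl_cons, ih, List.length_cons]; omega
  refine (foldl (G := fun _ x => x + 1) hl (const 0) (fun b => succ .id) hl.polyBdd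
    fun a l hl => ?_).congr fun a => by rw [key, zero_add]
  rw [key]
  simpa using hl.length_le

theorem countTrue {l : α → List Bool} (hl : PolyTime l) : PolyTime fun a => (l a).count true := by
  have key (l : List Bool) (n : ℕ) :
      l.foldl (fun x (b : Bool) => if b then x + 1 else x) n = n + l.count true := by
    induction l generalizing n with
    | nil => rfl
    | cons b l ih => rw [List.foldl_cons, ih, List.count_cons]; cases b <;> simp; omega
  refine (foldl (G := fun b x => if b then x + 1 else x) hl (const 0)
    (fun b => by cases b <;> simp [PolyTime.id, succ PolyTime.id]) hl.polyBdd
    fun a l hl => ?_).congr fun a => by rw [key, zero_add]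
  rw [key]
  have := List.count_le_length (a := true) (l := l)
  have := hl.length_le
  simp; omega

end PolyTime

/-- The number of bits `true` before the first bit `false`. -/
def leadTrue (l : List Bool) : ℕ := (l.takeWhile id).length

theorem leadTrue_unary (n : ℕ) (l : List Bool) : leadTrue (unary n ++ l) = n := by
  simp only [leadTrue, unary, List.append_assoc, List.singleton_append]
  rw [List.takeWhile_append_of_pos (by simp +contextual)]
  simp

theorem getElem?_leadTrue {l : List Bool} (h : leadTrue l < l.length) :
    l[leadTrue l]? = some false := by
  induction l with
  | nil => simp at h
  | cons b l ih =>
    cases b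
    · rfl
    · simp only [leadTrue, List.takeWhile_cons, id, if_true, List.length_cons] at *
      simpa using ih (by omega)

theorem getElem?_of_lt_leadTrue {l : List Bool} {i : ℕ} (h : i < leadTrue l) :
    l[i]? = some true := by
  induction l generalizing i with
  | nil => simp [leadTrue] at h
  | cons b l ih =>
    cases b
    · simp [leadTrue] at h
    · cases i
      · rfl
      · simp only [leadTrue, List.takeWhile_cons, id, if_true, List.length_cons] at *
        simpa using ih (by omega)

theorem PolyTime.leadTrue {l : α → List Bool} (hl : PolyTime l) :
    PolyTime fun a => leadTrue (l a) := by
  have key (l : List Bool) (n : ℕ) (c : Bool) : (l.foldl (fun (x : Bool × ℕ) b =>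
      if b && x.1 then (true, x.2 + 1) else (false, x.2)) (c, n)).2 =
      n + if c then Complexity.leadTrue l else 0 := by
    induction l generalizing n c with
    | nil => cases c <;> rfl
    | cons b l ih =>
      rw [List.foldl_cons]
      cases b <;> cases c <;> simp only [Bool.and_true, Bool.and_false, if_true, if_false, ih,
        Bool.false_eq_true, Complexity.leadTrue, List.takeWhile_cons, id, List.length_cons,
        List.length_nil]
      omega
  refine (foldl (G := fun b (x : Bool × ℕ) => if b && x.1 then (true, x.2 + 1) else (false, x.2)) hl
    ((const true).pair (const 0)) (fun b => cond ((const b).and (fst .id))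
      ((const true).pair (succ (snd .id))) ((const false).pair (snd .id)))
    ((PolyBdd.const 1).add hl.polyBdd) fun a l hl => ?_).snd.congr fun a => by rw [key]; simp
  rw [size_prod, size_bool, size_nat, key]
  have h1 := hl.length_le
  have h2 : Complexity.leadTrue l ≤ l.length := (List.takeWhile_prefix _).length_le
  simp; omega

namespace PolyTime

/-- The concatenation of polynomially many strings. -/
theorem flatMap {n : α → ℕ} {G : α → ℕ → List Bool} (hn : PolyTime n)
    (hG : PolyTime fun x : α × ℕ => G x.1 x.2) :
    PolyTime fun a => (List.range (n a)).flatMap (G a) := by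
  have key (a : α) (m : ℕ) : (fun x : (α × ℕ) × List Bool => ((x.1.1, x.1.2 + 1),
      x.2 ++ G x.1.1 x.1.2))^[m] ((a, 0), []) = ((a, m), (List.range m).flatMap (G a)) := by
    induction m with
    | zero => rfl
    | succ m ih => rw [iterate_succ_apply', ih]; simp [List.range_succ, List.flatMap_append]
  obtain ⟨q, hq⟩ := hG.polyBdd
  refine (iterate hn ((PolyTime.id.pair (const 0)).pair (const []))
    (((fst (fst .id)).pair (succ (snd (fst .id)))).pair ((snd .id).append (hG.comp (fst .id))))
    (((PolyBdd.size.add hn.polyBdd_nat)).add (hn.polyBdd_nat.mul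
      ((PolyBdd.size.add hn.polyBdd_nat).eval q))) fun a m hm => ?_).snd.congr fun a => by rw [key]
  rw [key]
  have h1 : ((List.range m).flatMap (G a)).length ≤ n a * q.eval (size a + n a) := by
    rw [List.length_flatMap]
    refine (List.sum_le_card_nsmul _ (q.eval (size a + n a)) ?_).trans ?_
    · intro k hk
      obtain ⟨i, hi, rfl⟩ := List.mem_map.1 hk
      rw [List.mem_range] at hi
      have := hq (a, i)
      simp only [size_list] at this
      exact this.trans (eval_mono q (by simp; omega))
    · simpa using Nat.mul_le_mul_right _ hm
  simp only [size_prod, size_nat, size_list]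
  omega

theorem map_range {n : α → ℕ} {P : α → ℕ → Bool} (hn : PolyTime n)
    (hP : PolyTime fun x : α × ℕ => P x.1 x.2) :
    PolyTime fun a => (List.range (n a)).map (P a) :=
  (flatMap hn hP.singleton).congr fun a => by rw [List.map_eq_flatMap]

end PolyTime

/-- The least `i < n` with `P i`, or `n` if there is none. -/
def firstIdx (n : ℕ) (P : ℕ → Bool) : ℕ := leadTrue ((List.range n).map fun i => !P i)

theorem firstIdx_le (n : ℕ) (P : ℕ → Bool) : firstIdx n P ≤ n := by
  have := (List.takeWhile_prefix (l := (List.range n).map fun i => !P i) id).length_le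
  simpa [firstIdx, leadTrue] using this

theorem firstIdx_spec {n : ℕ} {P : ℕ → Bool} (h : firstIdx n P < n) : P (firstIdx n P) = true := by
  have := getElem?_leadTrue (l := (List.range n).map fun i => !P i) (by simpa [firstIdx] using h)
  change ((List.range n).map fun i => !P i)[firstIdx n P]? = _ at this
  simpa [h] using this

theorem eq_false_of_firstIdx_eq {n : ℕ} {P : ℕ → Bool} (h : firstIdx n P = n) {i : ℕ}
    (hi : i < n) : P i = false := by
  have := getElem?_of_lt_leadTrue (l := (List.range n).map fun i => !P i)
    (i := i) (by change i < firstIdx n P; omega)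
  simpa [hi] using this

theorem PolyTime.firstIdx {n : α → ℕ} {P : α → ℕ → Bool} (hn : PolyTime n)
    (hP : PolyTime fun x : α × ℕ => P x.1 x.2) : PolyTime fun a => firstIdx (n a) (P a) :=
  (map_range hn hP.not).leadTrue

/-- A function to a finite type of which each fibre is decidable in polynomial time. -/
def FinTime {Φ : Type} [DecidableEq Φ] (g : α → Φ) : Prop :=
  ∀ c, PolyTime fun a => decide (g a = c)

namespace FinTime

variable {Φ Ψ : Type} [DecidableEq Φ] [DecidableEq Ψ]

theorem of_bool {c : α → Bool} (hc : PolyTime c) : FinTime c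
  | true => hc.congr fun a => by simp
  | false => hc.not.congr fun a => by cases c a <;> rfl

theorem pair {g : α → Φ} {h : α → Ψ} (hg : FinTime g) (hh : FinTime h) :
    FinTime fun a => (g a, h a) :=
  fun c => ((hg c.1).and (hh c.2)).congr fun a => by
    rw [← Bool.decide_and, decide_eq_decide, Prod.ext_iff]

theorem polyTime [Fintype Φ] {g : α → Φ} (hg : FinTime g) (F : Φ → Bool) :
    PolyTime fun a => F (g a) := by
  have key (S : Finset Φ) : PolyTime fun a => decide (g a ∈ S) := by
    induction S using Finset.induction_on with
    | empty => exact (PolyTime.const false).congr fun a => by simp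
    | insert c S _ ih => exact ((hg c).or ih).congr fun a => by simp
  exact (key (Finset.univ.filter fun c => F c = true)).congr fun a => by simp

end FinTime

end Complexity

/-! ### Minimum vertex covers -/

namespace SimpleGraph

variable {V W : Type*} {G H : SimpleGraph V}

theorem isMinVertexCover_iff [Finite V] {S : Set V} :
    G.IsMinVertexCover S ↔ G.IsVertexCover S ∧ ∀ T, G.IsVertexCover T → S.ncard ≤ T.ncard := by
  refine and_congr_right fun hS => ⟨fun h T hT => ?_, fun h => ?_⟩
  · have := hT.vertexCoverNum_le
    rw [← h, ← (Set.toFinite S).cast_ncard_eq, ← (Set.toFinite T).cast_ncard_eq] at this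
    exact_mod_cast this
  · refine le_antisymm ?_ hS.vertexCoverNum_le
    obtain ⟨T, hT, hcard⟩ := G.vertexCoverNum_exists
    rw [hT.symm, ← (Set.toFinite S).cast_ncard_eq, ← (Set.toFinite T).cast_ncard_eq]
    exact_mod_cast h T hcard

theorem exists_isMinVertexCover (G : SimpleGraph V) : ∃ S, G.IsMinVertexCover S := by
  obtain ⟨T, hT, hcard⟩ := G.vertexCoverNum_exists
  exact ⟨T, hcard, hT⟩

/-- The graph `G` without the edges that meet `D`. -/
def without (G : SimpleGraph V) (D : Set V) : SimpleGraph V where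
  Adj u v := G.Adj u v ∧ u ∉ D ∧ v ∉ D
  symm := ⟨fun _ _ h => ⟨h.1.symm, h.2.2, h.2.1⟩⟩
  loopless := ⟨fun _ h => h.1.ne rfl⟩

/-- If `D` is part of a minimum vertex cover, then so is its union with a part of a minimum vertex
cover of the rest of the graph. -/
theorem exists_isMinVertexCover_union [Finite V] {D X S T : Set V} (hS : G.IsMinVertexCover S)
    (hD : D ⊆ S) (hT : (G.without D).IsMinVertexCover T) (hX : X ⊆ T) :
    ∃ S', G.IsMinVertexCover S' ∧ D ∪ X ⊆ S' := by
  rw [isMinVertexCover_iff] at hS hT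
  refine ⟨D ∪ T, isMinVertexCover_iff.2 ⟨fun u v huv => ?_, fun T' hT' => ?_⟩,
    Set.union_subset_union_right D hX⟩
  · by_cases hu : u ∈ D
    · exact .inl (.inl hu)
    by_cases hv : v ∈ D
    · exact .inr (.inl hv)
    exact (hT.1 (show (G.without D).Adj u v from ⟨huv, hu, hv⟩)).imp .inr .inr
  · have h1 : (G.without D).IsVertexCover (S \ D) := fun u v huv =>
      (hS.1 huv.1).imp (⟨·, huv.2.1⟩) (⟨·, huv.2.2⟩)
    have h2 := hT.2 _ h1
    have h3 := Set.ncard_sdiff_add_ncard_of_subset hD (Set.toFinite S)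
    have h4 := Set.ncard_union_le D T
    have h5 := hS.2 T' hT'
    omega

section Pendant

variable {H' : SimpleGraph W} {ι : V → W} {w : W} {u v : V}

/-- The graph `H'` arises from `H` by attaching a new vertex `w` to the vertex `u`. -/
structure IsPendant (H : SimpleGraph V) (H' : SimpleGraph W) (ι : V → W) (w : W) (u : V) :
    Prop where
  injective : ι.Injective
  ne : ∀ a, ι a ≠ w
  eq_or : ∀ x, x = w ∨ ∃ a, x = ι a
  adj : ∀ a b, H'.Adj (ι a) (ι b) ↔ H.Adj a b
  adj_new : ∀ a, H'.Adj (ι a) w ↔ a = u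

namespace IsPendant

theorem isVertexCover_preimage (h : IsPendant H H' ι w u) {T : Set W} (hT : H'.IsVertexCover T) :
    H.IsVertexCover (ι ⁻¹' T) :=
  fun _ _ hab => hT ((h.adj _ _).2 hab)

theorem ncard_preimage_add [Finite W] (h : IsPendant H H' ι w u) {T : Set W} (hw : w ∈ T) :
    (ι ⁻¹' T).ncard + 1 ≤ T.ncard := by
  rw [← Set.ncard_image_of_injective _ h.injective, ← Set.ncard_insert_of_notMem (a := w)]
  · exact Set.ncard_le_ncard (Set.insert_subset hw (Set.image_preimage_subset _ _))
      (Set.toFinite _)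
  · rintro ⟨a, -, ha⟩
    exact h.ne a ha

theorem ncard_preimage_le [Finite W] (h : IsPendant H H' ι w u) (T : Set W) :
    (ι ⁻¹' T).ncard ≤ T.ncard := by
  rw [← Set.ncard_image_of_injective _ h.injective]
  exact Set.ncard_le_ncard (Set.image_preimage_subset _ _) (Set.toFinite _)

theorem isVertexCover_image (h : IsPendant H H' ι w u) {S : Set V} (hS : H.IsVertexCover S)
    (hu : u ∈ S) : H'.IsVertexCover (ι '' S) := by
  intro x y hxy
  rcases h.eq_or x with rfl | ⟨a, rfl⟩ <;> rcases h.eq_or y with rfl | ⟨b, rfl⟩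
  · exact absurd rfl hxy.ne
  · exact .inr ⟨b, ((h.adj_new b).1 hxy.symm) ▸ hu, rfl⟩
  · exact .inl ⟨a, ((h.adj_new a).1 hxy) ▸ hu, rfl⟩
  · exact (hS ((h.adj a b).1 hxy)).imp (⟨a, ·, rfl⟩) (⟨b, ·, rfl⟩)

/-- If `u` is in no minimum vertex cover of `H`, then any edge at `u` is strong in `H'`. -/
theorem exists_mem_of_forall_not [Finite V] [Finite W] (h : IsPendant H H' ι w u) (huv : H.Adj u v)
    (hno : ∀ i j, ¬ H'.IsStrongEdge i j) : ∃ T, H.IsMinVertexCover T ∧ u ∈ T := by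
  by_contra! hcon
  obtain ⟨S, hS⟩ := H.exists_isMinVertexCover
  have huS := hcon S hS
  have hS' := isMinVertexCover_iff.1 hS
  have hvS : v ∈ S := (hS'.1 huv).resolve_left huS
  refine hno (ι u) (ι v) ⟨(h.adj u v).2 huv, ι '' insert u S, isMinVertexCover_iff.2
    ⟨h.isVertexCover_image (hS'.1.subset (Set.subset_insert u S)) (Set.mem_insert u S),
      fun T hT => ?_⟩, ⟨u, .inl rfl, rfl⟩, ⟨v, .inr hvS, rfl⟩⟩
  rw [Set.ncard_image_of_injective _ h.injective, Set.ncard_insert_of_notMem huS]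
  have h1 := hS'.2 _ (h.isVertexCover_preimage hT)
  by_cases hw : w ∈ T
  · have := h.ncard_preimage_add hw
    omega
  · have h2 := h.ncard_preimage_le T
    have hu : u ∈ ι ⁻¹' T := (hT ((h.adj_new u).2 rfl)).resolve_right hw
    by_contra hlt
    refine hcon (ι ⁻¹' T)
      (isMinVertexCover_iff.2 ⟨h.isVertexCover_preimage hT, fun T' hT' => ?_⟩) hu
    have := hS'.2 _ hT'
    omega

/-- If `H` has no strong edge and `v` is in no minimum vertex cover of `H`, then `u` is in all of
them, and those of `H'` are the same, so that `H'` has no strong edge. -/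
theorem exists_mem_of_isStrongEdge [Finite V] [Finite W] (h : IsPendant H H' ι w u)
    (huv : H.Adj u v) (hno : ∀ i j, ¬ H.IsStrongEdge i j) {i j : W} (hij : H'.IsStrongEdge i j) :
    ∃ T, H.IsMinVertexCover T ∧ v ∈ T := by
  by_contra! hcon
  obtain ⟨S, hS⟩ := H.exists_isMinVertexCover
  have hvS := hcon S hS
  have hS' := isMinVertexCover_iff.1 hS
  have huS : u ∈ S := (hS'.1 huv).resolve_right hvS
  obtain ⟨hadj, T, hT, hi, hj⟩ := hij
  have hT' := isMinVertexCover_iff.1 hT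
  have h1 := hT'.2 _ (h.isVertexCover_image hS'.1 huS)
  rw [Set.ncard_image_of_injective _ h.injective] at h1
  have h2 := hS'.2 _ (h.isVertexCover_preimage hT'.1)
  have hw : w ∉ T := fun hw => by
    have := h.ncard_preimage_add hw
    omega
  have h3 := h.ncard_preimage_le T
  obtain ⟨a, rfl⟩ := (h.eq_or i).resolve_left (fun e => hw (e ▸ hi))
  obtain ⟨b, rfl⟩ := (h.eq_or j).resolve_left (fun e => hw (e ▸ hj))
  refine hno a b ⟨(h.adj a b).1 hadj, ι ⁻¹' T, isMinVertexCover_iff.2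
    ⟨h.isVertexCover_preimage hT'.1, fun T' hT' => ?_⟩, hi, hj⟩
  have := hS'.2 _ hT'
  omega

end IsPendant

end Pendant

end SimpleGraph

namespace Complexity

/-! ### Instances of the strong edge problem -/

theorem flatMap_unary_injective {n : ℕ} {l l' : List (Fin n × Fin n)}
    (h : l.flatMap (fun e => unary e.1 ++ unary e.2) =
      l'.flatMap (fun e => unary e.1 ++ unary e.2)) : l = l' := by
  have key {m m' : ℕ} {s s' : List Bool} (h : unary m ++ s = unary m' ++ s') :
      m = m' ∧ s = s' := by
    have h1 : m = m' := by rw [← leadTrue_unary m s, h, leadTrue_unary]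
    subst h1
    exact ⟨rfl, List.append_cancel_left h⟩
  induction l generalizing l' with
  | nil =>
    cases l' with
    | nil => rfl
    | cons e l' => simp [unary] at h
  | cons e l ih =>
    cases l' with
    | nil => simp [unary] at h
    | cons e' l' =>
      simp only [List.flatMap_cons, List.append_assoc] at h
      obtain ⟨h1, h⟩ := key h
      obtain ⟨h2, h⟩ := key h
      rw [ih h, Prod.ext (Fin.ext h1) (Fin.ext h2)]

theorem Describes.unique {x : List Bool} {n n' : ℕ} {G : SimpleGraph (Fin n)}
    {G' : SimpleGraph (Fin n')} (h : Describes x G) (h' : Describes x G') :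
    (⟨n, G⟩ : Σ n, SimpleGraph (Fin n)) = ⟨n', G'⟩ := by
  obtain ⟨l, hl, rfl⟩ := h
  obtain ⟨l', hl', h⟩ := h'
  have h1 : n = n' := by
    have := congrArg leadTrue h
    rwa [leadTrue_unary, leadTrue_unary] at this
  subst h1
  have := flatMap_unary_injective (List.append_cancel_left h)
  subst this
  congr
  ext i j
  rw [hl, hl']

/-- The answers of an oracle for the strong edge problem. -/
theorem Solves.answer {f : Oracle} (hf : Solves f StrongEdgeProblem) {x : List Bool} {n : ℕ}
    {G : SimpleGraph (Fin n)} (hx : Describes x G) :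
    (∃ i j : Fin n, G.IsStrongEdge i j ∧ f x = unary i ++ unary j) ∨
      ((∀ i j : Fin n, ¬ G.IsStrongEdge i j) ∧ f x = []) := by
  obtain ⟨n', G', hx', h⟩ := hf x (by
    by_cases h : ∃ i j : Fin n, G.IsStrongEdge i j
    · obtain ⟨i, j, h⟩ := h
      exact ⟨_, n, G, hx, .inl ⟨i, j, h, rfl⟩⟩
    · push Not at h
      exact ⟨_, n, G, hx, .inr ⟨h, rfl⟩⟩)
  obtain ⟨rfl, h1⟩ := Sigma.mk.inj_iff.1 (hx.unique hx')
  rw [eq_of_heq h1]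
  exact h

theorem Solves.length_answer_le {f : Oracle} (hf : Solves f StrongEdgeProblem) {x : List Bool}
    {n : ℕ} {G : SimpleGraph (Fin n)} (hx : Describes x G) :
    (f x).length ≤ 2 * x.length := by
  obtain ⟨l, hl, hx'⟩ := id hx
  have hn : n ≤ x.length := by rw [hx']; simp [unary]
  obtain ⟨i, j, -, h⟩ | ⟨-, h⟩ := hf.answer hx
  · rw [h]
    simp [unary]; omega
  · simp [h]

theorem describes_of_list {m : ℕ} (l : List (ℕ × ℕ)) (hl : ∀ e ∈ l, e.1 < m ∧ e.2 < m)
    {G : SimpleGraph (Fin m)} (hG : ∀ i j : Fin m, G.Adj i j ↔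
      ((i : ℕ), (j : ℕ)) ∈ l ∨ ((j : ℕ), (i : ℕ)) ∈ l) :
    Describes (unary m ++ l.flatMap fun e => unary e.1 ++ unary e.2) G := by
  refine ⟨l.pmap (fun e h => (⟨e.1, h.1⟩, ⟨e.2, h.2⟩)) hl, fun i j => ?_, ?_⟩
  · simp [hG, List.mem_pmap, Fin.ext_iff, eq_comm]
  · congr 1
    clear hG
    induction l with
    | nil => rfl
    | cons e l ih =>
      rw [List.flatMap_cons, List.pmap, List.flatMap_cons, ih]

/-- The pairs of numbers below `n` with `e u v`. -/
def edges (n : ℕ) (e : ℕ → ℕ → Bool) : List (ℕ × ℕ) :=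
  (List.range n).flatMap fun u => (List.range n).flatMap fun v => if e u v then [(u, v)] else []

theorem mem_edges {n : ℕ} {e : ℕ → ℕ → Bool} {u v : ℕ} :
    (u, v) ∈ edges n e ↔ u < n ∧ v < n ∧ e u v = true := by
  simp only [edges, List.mem_flatMap, List.mem_range]
  constructor
  · rintro ⟨a, ha, b, hb, h⟩
    split_ifs at h with hab <;> simp_all
  · rintro ⟨hu, hv, h⟩
    exact ⟨u, hu, v, hv, by simp [h]⟩

/-- The code of the list of pairs of numbers below `n` with `e u v`. -/
def edgeCode (n : ℕ) (e : ℕ → ℕ → Bool) : List Bool :=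
  (List.range n).flatMap fun u => (List.range n).flatMap fun v =>
    if e u v then unary u ++ unary v else []

theorem flatMap_edges (n : ℕ) (e : ℕ → ℕ → Bool) :
    (edges n e).flatMap (fun e => unary e.1 ++ unary e.2) = edgeCode n e := by
  simp only [edges, edgeCode, List.flatMap_assoc]
  congr! 4 with u v
  split_ifs <;> simp

/-- The graph on `n` vertices in which `u` and `v` are adjacent if `e u v` or `e v u`. -/
def relGraph (n : ℕ) (e : ℕ → ℕ → Bool) : SimpleGraph (Fin n) :=
  SimpleGraph.fromRel fun i j => e i j = true

theorem relGraph_adj {n : ℕ} {e : ℕ → ℕ → Bool} (he : ∀ u, e u u = false) {i j : Fin n} :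
    (relGraph n e).Adj i j ↔ e i j = true ∨ e j i = true := by
  rw [relGraph, SimpleGraph.fromRel_adj, and_iff_right_iff_imp]
  rintro h rfl
  simp [he] at h

theorem describes_relGraph {n : ℕ} {e : ℕ → ℕ → Bool} (he : ∀ u, e u u = false) :
    Describes (unary n ++ edgeCode n e) (relGraph n e) := by
  rw [← flatMap_edges]
  refine describes_of_list _ (fun e h => ?_) fun i j => ?_
  · have := mem_edges.1 h
    exact ⟨this.1, this.2.1⟩
  · simp [relGraph_adj he, mem_edges]

/-- The first vertex that is the first component of an edge, or `n` if there is no edge. -/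
def firstEnd (n : ℕ) (e : ℕ → ℕ → Bool) : ℕ :=
  firstIdx n fun u => decide (firstIdx n (e u) < n)

theorem firstEnd_spec {n : ℕ} {e : ℕ → ℕ → Bool} (h : firstEnd n e < n) :
    firstIdx n (e (firstEnd n e)) < n ∧
      e (firstEnd n e) (firstIdx n (e (firstEnd n e))) = true := by
  have h1 : firstIdx n (e (firstEnd n e)) < n :=
    of_decide_eq_true (firstIdx_spec (P := fun u => decide (firstIdx n (e u) < n)) h)
  exact ⟨h1, firstIdx_spec h1⟩

theorem eq_false_of_firstEnd_eq {n : ℕ} {e : ℕ → ℕ → Bool} (h : firstEnd n e = n) {u v : ℕ}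
    (hu : u < n) (hv : v < n) : e u v = false := by
  have h1 := eq_false_of_firstIdx_eq h hu
  have h2 := firstIdx_le n (e u)
  exact eq_false_of_firstIdx_eq (by simp at h1; omega) hv

/-- The description of the graph `relGraph n e` with a new vertex attached to `firstEnd n e`. -/
def pendantCode (n : ℕ) (e : ℕ → ℕ → Bool) : List Bool :=
  unary (n + 1) ++ (edgeCode n e ++
    if firstEnd n e < n then unary (firstEnd n e) ++ unary n else [])

/-- The graph `relGraph n e` with a new vertex attached to `firstEnd n e`, if there is an edge. -/
def pendantGraph (n : ℕ) (e : ℕ → ℕ → Bool) : SimpleGraph (Fin (n + 1)) :=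
  SimpleGraph.fromRel fun i j => (i < n ∧ j < n ∧ e i j = true) ∨
    (firstEnd n e < n ∧ i.val = firstEnd n e ∧ j.val = n)

theorem pendantGraph_adj {n : ℕ} {e : ℕ → ℕ → Bool} (he : ∀ u, e u u = false)
    {i j : Fin (n + 1)} : (pendantGraph n e).Adj i j ↔
      ((i < n ∧ j < n ∧ e i j = true) ∨ (firstEnd n e < n ∧ i.val = firstEnd n e ∧ j.val = n)) ∨
      ((j < n ∧ i < n ∧ e j i = true) ∨ (firstEnd n e < n ∧ j.val = firstEnd n e ∧ i.val = n)) := by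
  rw [pendantGraph, SimpleGraph.fromRel_adj, and_iff_right_iff_imp]
  rintro h rfl
  simp [he] at h
  omega

theorem describes_pendantGraph {n : ℕ} {e : ℕ → ℕ → Bool} (he : ∀ u, e u u = false) :
    Describes (pendantCode n e) (pendantGraph n e) := by
  have h1 : edgeCode n e ++ (if firstEnd n e < n then unary (firstEnd n e) ++ unary n else []) =
      (edges n e ++ if firstEnd n e < n then [(firstEnd n e, n)] else []).flatMap
        (fun e => unary e.1 ++ unary e.2) := by
    rw [List.flatMap_append, flatMap_edges]
    congr 1
    split_ifs <;> simp
  rw [pendantCode, h1]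
  refine describes_of_list _ (fun e h => ?_) fun i j => ?_
  · obtain h | h := List.mem_append.1 h
    · have := mem_edges.1 h
      omega
    · split_ifs at h
      · simp at h; subst h; simp; omega
      · simp at h
  · rw [pendantGraph_adj he]
    simp only [List.mem_append, mem_edges]
    split_ifs with h <;> simp [h]

theorem isPendant_pendantGraph {n : ℕ} {e : ℕ → ℕ → Bool} (he : ∀ u, e u u = false)
    (h : firstEnd n e < n) : SimpleGraph.IsPendant (relGraph n e) (pendantGraph n e)
      Fin.castSucc (Fin.last n) ⟨firstEnd n e, h⟩ where
  injective := Fin.castSucc_injective n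
  ne := Fin.castSucc_ne_last
  eq_or x := by
    obtain rfl | ⟨a, rfl⟩ := x.eq_castSucc_or_eq_last.symm
    · exact .inl rfl
    · exact .inr ⟨a, rfl⟩
  adj a b := by
    rw [pendantGraph_adj he, relGraph_adj he]
    simp [a.2.ne, b.2.ne]
  adj_new a := by
    rw [pendantGraph_adj he]
    have := a.2
    simp [Fin.ext_iff]
    omega

/-- Membership in a set of vertices that is part of a minimum vertex cover of `relGraph n e`, where
`y` is the answer of the oracle to this graph, and `z` the one to `pendantGraph n e`. -/
def pick (n : ℕ) (e : ℕ → ℕ → Bool) (y z : List Bool) (w : ℕ) : Bool :=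
  if y.isEmpty then decide (firstEnd n e < n) &&
    decide (w = if z.isEmpty then firstEnd n e else firstIdx n (e (firstEnd n e)))
  else decide (w = leadTrue y) || decide (w = leadTrue (y.drop (leadTrue y + 1)))

theorem pick_spec {n : ℕ} {e : ℕ → ℕ → Bool} (he : ∀ u, e u u = false) {f : Oracle}
    (hf : Solves f StrongEdgeProblem) {X : Set (Fin n)}
    (hX : X = {i : Fin n | pick n e (f (unary n ++ edgeCode n e)) (f (pendantCode n e)) i}) :
    (∃ T, (relGraph n e).IsMinVertexCover T ∧ X ⊆ T) ∧ (∀ i ∈ X, ∃ j, (relGraph n e).Adj i j) ∧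
      (X = ∅ → relGraph n e = ⊥) := by
  obtain ⟨i, j, ⟨hij, T, hT, hi, hj⟩, h⟩ | ⟨hno, h⟩ := hf.answer (describes_relGraph he)
  · have h1 : leadTrue (unary i ++ unary j) = i := leadTrue_unary _ _
    have h2 : (unary i ++ unary j).drop (i + 1) = unary j :=
      List.drop_left' (by simp [unary])
    have h3 : leadTrue (unary j) = j := by simpa using leadTrue_unary j []
    have h4 : (unary i ++ unary j).isEmpty = false := by simp [unary]
    have hX' : X = {i, j} := by
      rw [hX, h]
      ext k
      simp [pick, h1, h2, h3, h4, Fin.ext_iff]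
    subst hX'
    refine ⟨⟨T, hT, by simp [Set.insert_subset_iff, hi, hj]⟩, ?_,
      fun h0 => absurd h0 (Set.insert_nonempty _ _).ne_empty⟩
    rintro k (rfl | rfl)
    exacts [⟨_, hij⟩, ⟨_, hij.symm⟩]
  · by_cases hu : firstEnd n e < n
    · obtain ⟨hv, huv⟩ := firstEnd_spec hu
      have hadj : (relGraph n e).Adj ⟨_, hu⟩ ⟨_, hv⟩ := (relGraph_adj he).2 (.inl huv)
      have hp := isPendant_pendantGraph he hu
      obtain ⟨i, j, hij, h'⟩ | ⟨hno', h'⟩ := hf.answer (describes_pendantGraph he)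
      · have hX' : X = {⟨_, hv⟩} := by
          have hne : (unary i ++ unary j).isEmpty = false := by simp [unary]
          rw [hX, h, h']
          ext k
          simp only [pick, hu, hne, List.isEmpty_nil, if_true, decide_true, Bool.true_and,
            Bool.false_eq_true, if_false, Set.mem_ofPred_eq, decide_eq_true_eq,
            Set.mem_singleton_iff, Fin.ext_iff]
        subst hX'
        obtain ⟨T, hT, hvT⟩ := hp.exists_mem_of_isStrongEdge hadj hno hij
        exact ⟨⟨T, hT, by simpa⟩, by rintro k rfl; exact ⟨_, hadj.symm⟩, by simp⟩
      · have hX' : X = {⟨_, hu⟩} := by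
          rw [hX, h, h']
          ext k
          simp [pick, hu, Fin.ext_iff]
        subst hX'
        obtain ⟨T, hT, huT⟩ := hp.exists_mem_of_forall_not hadj hno'
        exact ⟨⟨T, hT, by simpa⟩, by rintro k rfl; exact ⟨_, hadj⟩, by simp⟩
    · have hX' : X = ∅ := by
        rw [hX, h]
        ext k
        simp [pick, hu]
      subst hX'
      obtain ⟨T, hT⟩ := (relGraph n e).exists_isMinVertexCover
      refine ⟨⟨T, hT, Set.empty_subset T⟩, by simp, fun _ => ?_⟩
      have hn : firstEnd n e = n := le_antisymm (firstIdx_le _ _) (by omega)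
      ext i j
      simp [relGraph_adj he, eq_false_of_firstEnd_eq hn]

end Complexity

namespace Complexity

open Function Polynomial

/-! ### Computing a minimum vertex cover with an oracle for strong edges -/

namespace PolyTime

variable {α : Type} [Enc α] {n : α → ℕ} {e : α → ℕ → ℕ → Bool}

theorem unary (hn : PolyTime n) : PolyTime fun a => unary (n a) :=
  hn.replicate.append (const _)

theorem edgeCode (hn : PolyTime n) (he : PolyTime fun x : (α × ℕ) × ℕ => e x.1.1 x.1.2 x.2) :
    PolyTime fun a => edgeCode (n a) (e a) := by
  refine flatMap hn ?_
  refine flatMap (n := fun x : α × ℕ => n x.1)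
    (G := fun (x : α × ℕ) v =>
      if e x.1 x.2 v then Complexity.unary x.2 ++ Complexity.unary v else [])
    (hn.comp (fst .id)) ?_
  exact cond he ((unary (snd (fst .id))).append (unary (snd .id))) (const [])

theorem firstNeighbour (hn : PolyTime n)
    (he : PolyTime fun x : (α × ℕ) × ℕ => e x.1.1 x.1.2 x.2) {u : α → ℕ} (hu : PolyTime u) :
    PolyTime fun a => Complexity.firstIdx (n a) (e a (u a)) :=
  firstIdx hn (he.comp (((fst .id).pair (hu.comp (fst .id))).pair (snd .id)))

theorem firstEnd (hn : PolyTime n) (he : PolyTime fun x : (α × ℕ) × ℕ => e x.1.1 x.1.2 x.2) :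
    PolyTime fun a => firstEnd (n a) (e a) := by
  refine firstIdx hn (lt (firstNeighbour (n := fun x : α × ℕ => n x.1)
    (e := fun x : α × ℕ => e x.1) (hn.comp (fst .id)) ?_ (snd .id)) (hn.comp (fst .id)))
  exact he.comp (((fst (fst (fst .id))).pair (snd (fst .id))).pair (snd .id))

theorem pendantCode (hn : PolyTime n) (he : PolyTime fun x : (α × ℕ) × ℕ => e x.1.1 x.1.2 x.2) :
    PolyTime fun a => pendantCode (n a) (e a) := by
  have hu := firstEnd hn he
  exact ((unary hn.succ).append ((edgeCode hn he).append
    (cond (lt hu hn) ((unary hu).append (unary hn)) (const [])))).congr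
    fun a => by simp [Complexity.pendantCode]

theorem pick (hn : PolyTime n) (he : PolyTime fun x : (α × ℕ) × ℕ => e x.1.1 x.1.2 x.2)
    {y z : α → List Bool} {w : α → ℕ} (hy : PolyTime y) (hz : PolyTime z) (hw : PolyTime w) :
    PolyTime fun a => pick (n a) (e a) (y a) (z a) (w a) := by
  have hu := firstEnd hn he
  exact cond hy.isEmpty ((lt hu hn).and (eq hw (cond hz.isEmpty hu (firstNeighbour hn he hu))))
    ((eq hw hy.leadTrue).or (eq hw (hy.drop hy.leadTrue.succ).leadTrue))

end PolyTime

variable (n : List Bool → ℕ) (r : List Bool → ℕ → ℕ → Bool)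

/-- The edges of the graph given by `n x` and `r x` that do not meet the set of vertices with the
bit list `D`. -/
def remaining (s : List Bool × List Bool) (u v : ℕ) : Bool :=
  r s.1 u v && !decide (u = v) && (!s.2.getD u false && !s.2.getD v false)

/-- One round of the algorithm: two oracle calls, after which one or two vertices are added to the
part `D` of a minimum vertex cover. -/
def round (f : Oracle) (s : List Bool × List Bool) : List Bool × List Bool :=
  (s.1, (List.range (n s.1)).map fun w => s.2.getD w false || pick (n s.1) (remaining r s)
    (f (unary (n s.1) ++ edgeCode (n s.1) (remaining r s)))
    (f (pendantCode (n s.1) (remaining r s))) w)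

theorem remaining_self (s : List Bool × List Bool) (u : ℕ) : remaining r s u u = false := by
  simp [remaining]

variable {n r}

theorem polyTimeO_round (hn : PolyTime n)
    (hr : PolyTime fun x : List Bool × (ℕ × ℕ) => r x.1 x.2.1 x.2.2) :
    PolyTimeO {f | Solves f StrongEdgeProblem} (round n r) := by
  have hn' : PolyTime fun s : List Bool × List Bool => n s.1 := hn.comp (.fst .id)
  have he : PolyTime fun x : ((List Bool × List Bool) × ℕ) × ℕ => remaining r x.1.1 x.1.2 x.2 := by
    have h1 : PolyTime fun x : ((List Bool × List Bool) × ℕ) × ℕ => x.1.2 := .snd (.fst .id)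
    have h2 : PolyTime fun x : ((List Bool × List Bool) × ℕ) × ℕ => x.2 := .snd .id
    have h3 : PolyTime fun x : ((List Bool × List Bool) × ℕ) × ℕ => x.1.1.2 :=
      .snd (.fst (.fst .id))
    have h4 : PolyTime fun x : ((List Bool × List Bool) × ℕ) × ℕ => x.1.1.1 :=
      .fst (.fst (.fst .id))
    exact ((hr.comp (h4.pair (h1.pair h2))).and (h1.eq h2).not).and
      ((h3.getD h1).not.and (h3.getD h2).not)
  have call {Q : List Bool × List Bool → List Bool} {m : List Bool × List Bool → ℕ}
      {G : ∀ s, SimpleGraph (Fin (m s))} (hQ : PolyTime Q) (hG : ∀ s, Describes (Q s) (G s)) :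
      PolyTimeO {f | Solves f StrongEdgeProblem} fun f s => f (Q s) := by
    refine PolyTimeO.oracle (hQ.with_oracle _) ?_
    obtain ⟨q, hq⟩ := hQ.polyBdd
    refine ⟨C 2 * q, fun f hf s => ?_⟩
    have h1 := Solves.length_answer_le hf (hG s)
    have h2 := hq s
    simp only [size_list, eval_mul, eval_C] at h2 ⊢
    omega
  have h1 := call ((hn'.unary).append (hn'.edgeCode he)) fun s =>
    describes_relGraph (remaining_self r s)
  have h2 := call (hn'.pendantCode he) fun s => describes_pendantGraph (remaining_self r s)
  have h3 : PolyTime fun t : (List Bool × List Bool) × (List Bool × List Bool) =>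
      (t.1.1, (List.range (n t.1.1)).map fun w => t.1.2.getD w false ||
        pick (n t.1.1) (remaining r t.1) t.2.1 t.2.2 w) := by
    have hs : PolyTime fun t : (List Bool × List Bool) × (List Bool × List Bool) => t.1 := .fst .id
    refine hs.fst.pair (PolyTime.map_range
      (P := fun (t : (List Bool × List Bool) × (List Bool × List Bool)) w =>
        t.1.2.getD w false || pick (n t.1.1) (remaining r t.1) t.2.1 t.2.2 w)
      (hn'.comp hs) ((PolyTime.getD (.snd (.fst (.fst .id))) (.snd .id)).or ?_))
    refine PolyTime.pick (n := fun x : ((List Bool × List Bool) × (List Bool × List Bool)) × ℕ =>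
      n x.1.1.1) (e := fun x => remaining r x.1.1) (hn'.comp (.fst (.fst .id))) ?_
      (.fst (.snd (.fst .id))) (.snd (.snd (.fst .id))) (.snd .id)
    exact he.comp (((PolyTime.fst (.fst (.fst (.fst .id)))).pair (.snd (.fst .id))).pair
      (.snd .id))
  exact (h3.with_oracle _).comp (PolyTimeO.id.pair (h1.pair h2))

/-- The set of vertices below `m` given by a bit list. -/
def vertexSet (m : ℕ) (D : List Bool) : Set (Fin m) := {i | D.getD i false = true}

theorem vertexSet_map {m : ℕ} (P : ℕ → Bool) :
    vertexSet m ((List.range m).map P) = {i : Fin m | P i = true} := by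
  ext i
  simp [vertexSet]

theorem ncard_vertexSet (m : ℕ) (D : List Bool) : (vertexSet m D).ncard =
    ((List.range m).map fun i => D.getD i false).count true := by
  rw [vertexSet, Set.ncard_eq_toFinset_card', ← List.map_coe_finRange_eq_range, List.map_map,
    List.count, List.countP_map, List.countP_eq_length_filter]
  simp [Finset.card, Finset.filter, Fin.univ_def, Function.comp_def]

theorem relGraph_remaining {x D : List Bool} :
    relGraph (n x) (remaining r (x, D)) = (relGraph (n x) (r x)).without (vertexSet (n x) D) := by
  ext i j
  rw [relGraph_adj (remaining_self r _)]
  simp only [SimpleGraph.without, vertexSet, relGraph, SimpleGraph.fromRel_adj, remaining,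
    Set.mem_ofPred_eq, Bool.and_eq_true, Bool.not_eq_true', decide_eq_false_iff_not,
    ← Fin.ext_iff, ne_eq, Bool.not_eq_true]
  tauto

/-- The invariant of the algorithm: the set given by `D` is part of a minimum vertex cover, and
after `m` rounds it has at least `m` elements, unless no edge remains. -/
theorem iterate_round_spec {f : Oracle} (hf : Solves f StrongEdgeProblem) (x : List Bool) (m : ℕ) :
    ∃ D, (round n r f)^[m] (x, []) = (x, D) ∧
      (∃ S, (relGraph (n x) (r x)).IsMinVertexCover S ∧ vertexSet (n x) D ⊆ S) ∧
      ((relGraph (n x) (r x)).without (vertexSet (n x) D) = ⊥ ∨ m ≤ (vertexSet (n x) D).ncard) := by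
  induction m with
  | zero =>
    obtain ⟨S, hS⟩ := (relGraph (n x) (r x)).exists_isMinVertexCover
    exact ⟨[], rfl, ⟨S, hS, by intro i hi; simp [vertexSet] at hi⟩, .inr (Nat.zero_le _)⟩
  | succ m ih =>
    obtain ⟨D, h1, ⟨S, hS, hDS⟩, h3⟩ := ih
    rw [iterate_succ_apply', h1]
    refine ⟨_, rfl, ?_⟩
    obtain ⟨⟨T, hT, hXT⟩, hX, hX0⟩ := pick_spec (remaining_self r (x, D)) hf rfl
    rw [vertexSet_map]
    rw [relGraph_remaining] at hT hX hX0
    have hU : {i : Fin (n x) | (D.getD i false || pick (n x) (remaining r (x, D))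
        (f (unary (n x) ++ edgeCode (n x) (remaining r (x, D))))
        (f (pendantCode (n x) (remaining r (x, D)))) i) = true} = vertexSet (n x) D ∪
        {i : Fin (n x) | pick (n x) (remaining r (x, D))
          (f (unary (n x) ++ edgeCode (n x) (remaining r (x, D))))
          (f (pendantCode (n x) (remaining r (x, D)))) i = true} := by
      ext i
      simp [vertexSet]
    simp only [hU]
    refine ⟨SimpleGraph.exists_isMinVertexCover_union hS hDS hT hXT, ?_⟩
    generalize {i : Fin (n x) | pick (n x) (remaining r (x, D))
          (f (unary (n x) ++ edgeCode (n x) (remaining r (x, D))))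
          (f (pendantCode (n x) (remaining r (x, D)))) i = true} = X at *
    generalize vertexSet (n x) D = E at *
    rcases X.eq_empty_or_nonempty with rfl | ⟨i, hi⟩
    · rw [Set.union_empty]
      exact .inl (hX0 rfl)
    · obtain ⟨j, hij⟩ := hX i hi
      refine .inr ?_
      have h4 : m ≤ E.ncard := h3.resolve_left fun h => by simp [h] at hij
      have h5 := Set.ncard_insert_of_notMem hij.2.1 (Set.toFinite E)
      have h6 := Set.ncard_le_ncard (Set.insert_subset (.inr hi) Set.subset_union_left :
        insert i E ⊆ E ∪ X) (Set.toFinite _)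
      omega

theorem isMinVertexCover_iterate_round {f : Oracle} (hf : Solves f StrongEdgeProblem)
    (x : List Bool) : (relGraph (n x) (r x)).IsMinVertexCover
      (vertexSet (n x) ((round n r f)^[n x] (x, [])).2) := by
  obtain ⟨D, h1, ⟨S, hS, hDS⟩, h3⟩ := iterate_round_spec (n := n) (r := r) hf x (n x)
  rw [h1]
  have hcov : (relGraph (n x) (r x)).IsVertexCover (vertexSet (n x) D) := by
    rcases h3 with h3 | h3
    · intro i j hij
      by_contra! h
      have : ((relGraph (n x) (r x)).without (vertexSet (n x) D)).Adj i j := ⟨hij, h.1, h.2⟩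
      simp [h3] at this
    · have : vertexSet (n x) D = Set.univ :=
        Set.eq_of_subset_of_ncard_le (Set.subset_univ _) (by simpa using h3)
      rw [this]
      exact fun _ _ _ => .inl trivial
  have hS' := SimpleGraph.isMinVertexCover_iff.1 hS
  rwa [Set.eq_of_subset_of_ncard_le hDS (hS'.2 _ hcov) (Set.toFinite S)]

/-- The vertex cover problem for a family of graphs given in polynomial time is Turing reducible to
the strong edge problem. -/
theorem exists_machine_of_vertexCover {k : List Bool → ℕ} (hn : PolyTime n)
    (hr : PolyTime fun x : List Bool × (ℕ × ℕ) => r x.1 x.2.1 x.2.2) (hk : PolyTime k)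
    {L : Language Bool} (hL : ∀ x, x ∈ L ↔ ∃ S : Set (Fin (n x)),
      (relGraph (n x) (r x)).IsVertexCover S ∧ S.ncard ≤ k x) :
    ∃ (M : Machine) (p : ℕ[X]), ∀ f, Solves f StrongEdgeProblem → M.DecidesInTime f L p := by
  have key (f : Oracle) (l : List Bool) (s : List Bool × List Bool) :
      l.foldl (fun s _ => round n r f s) s = (round n r f)^[l.length] s :=
    List.foldl_const _ _ _
  obtain ⟨q, hq⟩ := hn.polyBdd_nat
  have h1 : PolyTimeO {f | Solves f StrongEdgeProblem} fun f x =>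
      (List.replicate (n x) true).foldl (fun s _ => round n r f s) (x, []) := by
    refine PolyTimeO.foldl (G := fun _ => round n r) (hn.replicate.with_oracle _)
      ((PolyTime.id.pair (.const [])).with_oracle _) (fun _ => polyTimeO_round hn hr)
      ⟨X + q, fun f _ x l _ => ?_⟩
    rw [key, size_prod]
    have h (m : ℕ) : ((round n r f)^[m] (x, [])).1 = x ∧
        ((round n r f)^[m] (x, [])).2.length ≤ n x := by
      induction m with
      | zero => exact ⟨rfl, Nat.zero_le _⟩
      | succ m ih => rw [iterate_succ_apply']; exact ⟨ih.1, by simp [round, ih.1]⟩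
    have h1 := h l.length
    have h2 := hq x
    simp only [size_list, h1.1, eval_add, eval_X] at h2 ⊢
    omega
  have h2 : PolyTime fun s : List Bool × List Bool =>
      decide (((List.range (n s.1)).map fun i => s.2.getD i false).count true ≤ k s.1) :=
    .le (.countTrue (.map_range (P := fun (s : List Bool × List Bool) i => s.2.getD i false)
      (hn.comp (.fst .id)) (.getD (.snd (.fst .id)) (.snd .id)))) (hk.comp (.fst .id))
  obtain ⟨M, p, hM⟩ := ((h2.with_oracle _).comp h1).exists_machine
  refine ⟨M, p, fun f hf => hM f hf L fun x => ?_⟩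
  have h3 := isMinVertexCover_iterate_round (n := n) (r := r) hf x
  obtain ⟨D, h4, -⟩ := iterate_round_spec (n := n) (r := r) hf x (n x)
  rw [key, List.length_replicate, decide_eq_true_eq, hL]
  rw [h4] at h3 ⊢
  rw [← ncard_vertexSet]
  rw [SimpleGraph.isMinVertexCover_iff] at h3
  exact ⟨fun h => ⟨_, h3.1, h⟩, fun ⟨S, hS, hSk⟩ => (h3.2 S hS).trans hSk⟩

end Complexity

namespace Complexity

open Function Polynomial

/-! ### Constraint satisfaction and vertex covers -/

/-- In a graph whose vertices are the pairs of a cell and a symbol, any two vertices over the same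
cell being adjacent, the vertex covers with at most the number of vertices minus the number of
cells correspond to the fillings of the cells in which no two entries are adjacent. -/
theorem exists_isVertexCover_iff {V C Γ : Type*} [Fintype V] [Fintype C] [Nonempty Γ]
    (E : V ≃ C × Γ)
    (r : V → V → Prop) (hr : ∀ u v, u ≠ v → (E u).1 = (E v).1 → r u v) :
    (∃ S, (SimpleGraph.fromRel r).IsVertexCover S ∧
      S.ncard ≤ Fintype.card V - Fintype.card C) ↔
    ∃ A : C → Γ, ∀ c c', c ≠ c' → ¬ r (E.symm (c, A c)) (E.symm (c', A c')) := by
  constructor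
  · rintro ⟨S, hS, hcard⟩
    have hno {u v : V} (hu : u ∉ S) (hv : v ∉ S) (huv : u ≠ v) : ¬ r u v := fun h =>
      (hS (show (SimpleGraph.fromRel r).Adj u v from ⟨huv, .inl h⟩)).elim hu hv
    have hinj : Set.InjOn (fun u => (E u).1) Sᶜ := by
      intro u hu v hv huv
      by_contra hne
      exact hno hu hv hne (hr u v hne huv)
    have h1 := hinj.ncard_image
    have h2 := Set.ncard_add_ncard_compl S
    rw [Nat.card_eq_fintype_card] at h2
    have h4 : Fintype.card C ≤ Fintype.card V := by
      obtain ⟨g⟩ := ‹Nonempty Γ›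
      exact Fintype.card_le_of_injective (fun c => E.symm (c, g)) fun c c' h => by
        exact congrArg Prod.fst (E.symm.injective h)
    have h3 : (fun u => (E u).1) '' Sᶜ = Set.univ :=
      Set.eq_of_subset_of_ncard_le (Set.subset_univ _)
        (by rw [Set.ncard_univ, Nat.card_eq_fintype_card]; omega)
    have h5 (c : C) : ∃ g, E.symm (c, g) ∉ S := by
      obtain ⟨u, hu, rfl⟩ : c ∈ (fun u => (E u).1) '' Sᶜ := h3 ▸ Set.mem_univ c
      exact ⟨(E u).2, by simpa using hu⟩
    choose A hA using h5
    exact ⟨A, fun c c' hc => hno (hA c) (hA c') fun h => hc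
      (congrArg Prod.fst (E.symm.injective h))⟩
  · rintro ⟨A, hA⟩
    refine ⟨(Set.range fun c => E.symm (c, A c))ᶜ, fun u v huv => ?_, ?_⟩
    · by_contra! h
      simp only [Set.mem_compl_iff, not_not] at h
      obtain ⟨⟨c, rfl⟩, c', rfl⟩ := h
      have hc : c ≠ c' := by rintro rfl; exact huv.ne rfl
      exact huv.2.elim (hA c c' hc) (hA c' c hc.symm)
    · have h1 := Set.ncard_add_ncard_compl (Set.range fun c => E.symm (c, A c))
      have h2 : (Set.range fun c => E.symm (c, A c)).ncard = Fintype.card C := by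
        rw [← Set.image_univ, Set.ncard_image_of_injective _ (fun c c' h => ?_), Set.ncard_univ,
          Nat.card_eq_fintype_card]
        exact congrArg Prod.fst (E.symm.injective h)
      rw [Nat.card_eq_fintype_card] at h1
      omega

/-! ### The tableau of a computation -/

namespace Machine

variable (M : Machine)

/-- The symbols of the tableau: at time `t` and depth `i`, the state at time `t`, and for each stack
the bit at depth `i` below its top, if there is one. -/
abbrev Sym : Type := M.Q × (M.K → Option Bool)

/-- The condition on one entry `g` at time `t` and depth `i`: `first` stands for `t = 0` and `last`
for the end of the computation; the input is known to have the bit `b` at depth `i`, if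
`known`, and else it has some bit there, if `free`, and none, if not. -/
def EntryOK (first last known : Prop) (b : Bool) (free : Prop) (g : M.Sym) : Prop :=
  (first → g.1 = M.start ∧ (∀ k, k ≠ M.inp → g.2 k = none) ∧ (known → g.2 M.inp = some b) ∧
    (¬ known → free → g.2 M.inp ≠ none) ∧ (¬ known → ¬ free → g.2 M.inp = none)) ∧
  (last → M.instr g.1 = .halt true)

/-- The condition on two entries `g` at `(t, i)` and `g'` at `(t', i')`: `sameT` stands for
`t = t'`, `nextT` for `t' = t + 1`, `sameI` for `i = i'`, `nextI` for `i' = i + 1`, `prevI` for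
`i = i' + 1`, `zeroI` for `i = 0`, and `zeroI'` for `i' = 0`. -/
def PairOK (sameT nextT sameI nextI prevI zeroI zeroI' : Prop) (g g' : M.Sym) : Prop :=
  (sameT → g.1 = g'.1) ∧ (sameT → sameI → g = g') ∧
  (nextT → match M.instr g.1 with
    | .push k b q => g'.1 = q ∧ (∀ k', k' ≠ k → sameI → g'.2 k' = g.2 k') ∧
        (nextI → g'.2 k = g.2 k) ∧ (zeroI' → g'.2 k = some b)
    | .pop k next => (zeroI → g'.1 = next (g.2 k)) ∧
        (∀ k', k' ≠ k → sameI → g'.2 k' = g.2 k') ∧ (prevI → g'.2 k = g.2 k)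
    | .query _ => True
    | .halt _ => g'.1 = g.1 ∧ (sameI → g'.2 = g.2))

/-- The conditions on all entries `A t i`, for `t` and `i` at most `T`, of a tableau of an accepting
computation with an input that consists of `s` and `m` further bits. -/
def IsTableau (s : List Bool) (m T : ℕ) (A : ℕ → ℕ → M.Sym) : Prop :=
  (∀ t ≤ T, ∀ i ≤ T, M.EntryOK (t = 0) (t = T) (i < s.length) (s.getD i false)
    (i < s.length + m) (A t i)) ∧
  ∀ t ≤ T, ∀ i ≤ T, ∀ t' ≤ T, ∀ i' ≤ T, (t, i) ≠ (t', i') →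
    M.PairOK (t = t') (t' = t + 1) (i = i') (i' = i + 1) (i = i' + 1) (i = 0) (i' = 0)
      (A t i) (A t' i')

variable {M}

theorem exists_isTableau (hM : M.OracleFree) {s w : List Bool} {T : ℕ}
    (h : M.HaltsWithin id (s ++ w) T true) : ∃ A, M.IsTableau s w.length T A := by
  refine ⟨fun t i => (((M.step id)^[t] (M.init (s ++ w))).state,
    fun k => (((M.step id)^[t] (M.init (s ++ w))).stk k)[i]?), ?_, ?_⟩
  · rintro t - i -
    refine ⟨?_, ?_⟩
    · rintro rfl
      refine ⟨rfl, fun k hk => ?_, fun hi => ?_, fun hi hf => ?_, fun hi hf => ?_⟩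
      · simp [init, hk]
      · simp [init, hi, List.getElem?_append_left]
      · simp [init]; omega
      · simp [init]; omega
    · rintro rfl
      exact h
  · rintro t - i - t' - i' - -
    refine ⟨?_, ?_, ?_⟩
    · rintro rfl; rfl
    · rintro rfl rfl; rfl
    · rintro rfl
      simp only [iterate_succ_apply']
      generalize (M.step id)^[t] (M.init (s ++ w)) = c
      simp only [step]
      cases hc : M.instr c.state with
      | push k b q =>
        refine ⟨rfl, ?_, ?_, ?_⟩
        · rintro k' hk rfl; simp [hk]
        · rintro rfl; simp
        · rintro rfl; simp
      | pop k next =>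
        refine ⟨?_, ?_, ?_⟩
        · rintro rfl; simp [List.head?_eq_getElem?]
        · rintro k' hk rfl; simp [hk]
        · rintro rfl; simp
      | query q => exact absurd hc (hM _ _)
      | halt b => exact ⟨rfl, by rintro rfl; rfl⟩

/-- The entries of a tableau with `i + t ≤ T` are determined by the input, as each entry at time
`t + 1` depends on those at time `t` and depth at most one more. -/
theorem IsTableau.exists_haltsWithin (hM : M.OracleFree) {s : List Bool} {m T : ℕ}
    {A : ℕ → ℕ → M.Sym} (hA : M.IsTableau s m T A) :
    ∃ w : List Bool, w.length = m ∧ M.HaltsWithin id (s ++ w) T true := by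
  obtain ⟨h1, h2⟩ := hA
  refine ⟨(List.range m).map fun j => ((A 0 (s.length + j)).2 M.inp).getD false, by simp, ?_⟩
  set w := (List.range m).map fun j => ((A 0 (s.length + j)).2 M.inp).getD false with hw
  have key (t : ℕ) (ht : t ≤ T) :
      (∀ i ≤ T, (A t i).1 = ((M.step id)^[t] (M.init (s ++ w))).state) ∧
      ∀ i, i + t ≤ T → ∀ k, (A t i).2 k = (((M.step id)^[t] (M.init (s ++ w))).stk k)[i]? := by
    induction t with
    | zero =>
      refine ⟨fun i hi => ((h1 0 ht i hi).1 rfl).1, fun i hi k => ?_⟩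
      obtain ⟨-, h3, h4, h5, h6⟩ := (h1 0 ht i hi).1 rfl
      by_cases hk : k = M.inp
      · subst hk
        simp only [iterate_zero, id, init, update_self]
        rcases lt_or_ge i s.length with hs | hs
        · simp [h4 hs, hs, List.getElem?_append_left]
        · rw [List.getElem?_append_right hs]
          by_cases hm : i < s.length + m
          · obtain ⟨b, hb⟩ := Option.ne_none_iff_exists'.1 (h5 (by omega) hm)
            have : i - s.length < m := by omega
            simp [hw, this, Nat.add_sub_cancel' hs, hb]
          · rw [h6 (by omega) hm]
            simp [hw]; omega
      · rw [h3 k hk]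
        simp [init, hk]
    | succ t ih =>
      obtain ⟨ih1, ih2⟩ := ih (by omega)
      rw [iterate_succ_apply']
      generalize (M.step id)^[t] (M.init (s ++ w)) = c at *
      have hp (i i' : ℕ) (hi : i ≤ T) (hi' : i' ≤ T) := (h2 t (by omega) i hi (t + 1) ht i' hi'
        (by simp)).2.2 rfl
      have hstate (h : (A (t + 1) 0).1 = (M.step id c).state) (i : ℕ) (hi : i ≤ T) :
          (A (t + 1) i).1 = (M.step id c).state := by
        rcases Nat.eq_zero_or_pos i with rfl | h0
        · exact h
        · rw [← h]
          exact (h2 (t + 1) ht i hi (t + 1) ht 0 (by omega) (by simp; omega)).1 rfl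
      simp only [step] at hstate ⊢
      have hc (i : ℕ) (hi : i ≤ T) : M.instr (A t i).1 = M.instr c.state := by rw [ih1 i hi]
      cases hq : M.instr c.state with
      | push k b q =>
        rw [hq] at hstate
        refine ⟨hstate ?_, fun i hi k' => ?_⟩
        · have h := hp 0 0 (by omega) (by omega)
          rw [hc 0 (by omega), hq] at h
          exact h.1
        · by_cases hk : k' = k
          · subst hk
            rcases i with _ | i
            · have h := hp 0 0 (by omega) (by omega)
              rw [hc 0 (by omega), hq] at h
              simpa using h.2.2.2 rfl
            · have h := hp i (i + 1) (by omega) (by omega)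
              rw [hc i (by omega), hq] at h
              simpa [← ih2 i (by omega)] using h.2.2.1 rfl
          · have h := hp i i (by omega) (by omega)
            rw [hc i (by omega), hq] at h
            simpa [hk, ← ih2 i (by omega)] using h.2.1 k' hk rfl
      | pop k next =>
        rw [hq] at hstate
        refine ⟨hstate ?_, fun i hi k' => ?_⟩
        · have h := hp 0 0 (by omega) (by omega)
          rw [hc 0 (by omega), hq] at h
          simpa [List.head?_eq_getElem?, ← ih2 0 (by omega)] using h.1 rfl
        · by_cases hk : k' = k
          · subst hk
            have h := hp (i + 1) i (by omega) (by omega)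
            rw [hc (i + 1) (by omega), hq] at h
            simpa [← ih2 (i + 1) (by omega)] using h.2.2 rfl
          · have h := hp i i (by omega) (by omega)
            rw [hc i (by omega), hq] at h
            simpa [hk, ← ih2 i (by omega)] using h.2.1 k' hk rfl
      | query q => exact absurd hq (hM _ _)
      | halt b =>
        rw [hq] at hstate
        refine ⟨hstate ?_, fun i hi k' => ?_⟩
        · have h := hp 0 0 (by omega) (by omega)
          rw [hc 0 (by omega), hq] at h
          exact h.1.trans (ih1 0 (by omega))
        · have h := hp i i (by omega) (by omega)
          rw [hc i (by omega), hq] at h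
          exact (congrFun (h.2 rfl) k').trans (ih2 i (by omega) k')
  have h3 := (h1 T le_rfl 0 (Nat.zero_le T)).2 rfl
  rwa [(key T le_rfl).1 0 (Nat.zero_le T)] at h3

end Machine

end Complexity

namespace Complexity

open Function Polynomial

/-! ### From NP to vertex covers -/

namespace Machine

variable (M : Machine)

instance : Nonempty M.Sym := ⟨M.start, fun _ => none⟩

/-- The number of symbols. -/
def numSym : ℕ := Fintype.card M.Sym

theorem numSym_pos : 0 < M.numSym := Fintype.card_pos

/-- The time, the depth, and the symbol that the vertex `u` stands for, in the graph for tableaux of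
`R` rows and columns. -/
noncomputable def decode (R u : ℕ) : ℕ × ℕ × M.Sym :=
  (u / M.numSym / R, u / M.numSym % R,
    (Fintype.equivFin M.Sym).symm ⟨u % M.numSym, Nat.mod_lt _ M.numSym_pos⟩)

/-- The condition on one entry of a tableau. -/
def EntryCond (s : List Bool) (m T : ℕ) (c : ℕ × ℕ × M.Sym) : Prop :=
  M.EntryOK (c.1 = 0) (c.1 = T) (c.2.1 < s.length) (s.getD c.2.1 false)
    (c.2.1 < s.length + m) c.2.2

/-- The condition on two entries of a tableau. -/
def PairCond (c c' : ℕ × ℕ × M.Sym) : Prop :=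
  M.PairOK (c.1 = c'.1) (c'.1 = c.1 + 1) (c.2.1 = c'.2.1) (c'.2.1 = c.2.1 + 1)
    (c.2.1 = c'.2.1 + 1) (c.2.1 = 0) (c'.2.1 = 0) c.2.2 c'.2.2

open Classical in
/-- Adjacency in the graph for tableaux: the two entries violate the condition on pairs, or one of
them violates the condition on single entries. -/
noncomputable def clash (s : List Bool) (m T u v : ℕ) : Bool :=
  decide ¬ (M.EntryCond s m T (M.decode (T + 1) u) ∧ M.EntryCond s m T (M.decode (T + 1) v) ∧
    M.PairCond (M.decode (T + 1) u) (M.decode (T + 1) v))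

theorem exists_isVertexCover_clash_iff (s : List Bool) (m : ℕ) {T : ℕ} (hT : 0 < T) :
    (∃ S : Set (Fin ((T + 1) * (T + 1) * M.numSym)),
      (relGraph ((T + 1) * (T + 1) * M.numSym) (M.clash s m T)).IsVertexCover S ∧
        S.ncard ≤ (T + 1) * (T + 1) * M.numSym - (T + 1) * (T + 1)) ↔
    ∃ A, M.IsTableau s m T A := by
  let E : Fin ((T + 1) * (T + 1) * M.numSym) ≃ (Fin (T + 1) × Fin (T + 1)) × M.Sym :=
    finProdFinEquiv.symm.trans (finProdFinEquiv.symm.prodCongr (Fintype.equivFin M.Sym).symm)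
  have hE (u : Fin ((T + 1) * (T + 1) * M.numSym)) :
      M.decode (T + 1) u = ((E u).1.1.val, (E u).1.2.val, (E u).2) := rfl
  have hclash (u v : Fin ((T + 1) * (T + 1) * M.numSym)) : M.clash s m T u v = true ↔
      ¬ (M.EntryCond s m T ((E u).1.1.val, (E u).1.2.val, (E u).2) ∧
        M.EntryCond s m T ((E v).1.1.val, (E v).1.2.val, (E v).2) ∧
        M.PairCond ((E u).1.1.val, (E u).1.2.val, (E u).2)
          ((E v).1.1.val, (E v).1.2.val, (E v).2)) := by
    simp only [clash, decide_eq_true_eq, hE]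
  have h1 := exists_isVertexCover_iff E (fun u v => M.clash s m T u v = true) (by
    intro u v huv hc
    rw [hclash]
    intro h
    refine huv (E.injective (Prod.ext hc ?_))
    exact h.2.2.2.1 (by simp [hc]) (by simp [hc]))
  rw [Fintype.card_fin, Fintype.card_prod, Fintype.card_fin] at h1
  refine h1.trans ?_
  simp only [hclash, not_not, Equiv.apply_symm_apply]
  constructor
  · rintro ⟨A, hA⟩
    have : Nontrivial (Fin (T + 1)) := Fin.nontrivial_iff_two_le.2 (by omega)
    have hv (t : ℕ) (ht : t ≤ T) : (Fin.ofNat (T + 1) t).val = t :=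
      Nat.mod_eq_of_lt (by omega)
    refine ⟨fun t i => A (Fin.ofNat (T + 1) t, Fin.ofNat (T + 1) i), fun t ht i hi => ?_,
      fun t ht i hi t' ht' i' hi' hne => ?_⟩
    · -- An entry that violates the condition on single entries clashes with every other vertex, and
      -- there are others in the independent set, since `T > 0`.
      obtain ⟨c', hc'⟩ := exists_ne (Fin.ofNat (T + 1) t, Fin.ofNat (T + 1) i)
      have := (hA _ c' hc'.symm).1
      simpa only [EntryCond, hv t ht, hv i hi] using this
    · have := (hA (Fin.ofNat (T + 1) t, Fin.ofNat (T + 1) i)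
        (Fin.ofNat (T + 1) t', Fin.ofNat (T + 1) i') fun h => hne (by
          simp only [Prod.mk.injEq, Fin.ext_iff, hv t ht, hv i hi, hv t' ht', hv i' hi'] at h
          simp [h])).2.2
      simpa only [PairCond, hv t ht, hv i hi, hv t' ht', hv i' hi'] using this
  · rintro ⟨A, hA1, hA2⟩
    have hle (j : Fin (T + 1)) : j.val ≤ T := by omega
    refine ⟨fun c => A c.1 c.2, fun c c' hc => ⟨hA1 _ (hle _) _ (hle _), hA1 _ (hle _) _ (hle _),
      hA2 _ (hle _) _ (hle _) _ (hle _) _ (hle _) fun h => hc ?_⟩⟩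
    simpa [Prod.ext_iff, Fin.ext_iff] using h

end Machine

theorem FinTime.comp {α β Φ : Type} [Enc α] [Enc β] [DecidableEq Φ] {g : β → Φ} {F : α → β}
    (hg : FinTime g) (hF : PolyTime F) : FinTime fun a => g (F a) :=
  fun c => (hg c).comp hF

theorem Machine.polyTime_clash (M : Machine) {s : List Bool → List Bool} {m T : List Bool → ℕ}
    (hs : PolyTime s) (hm : PolyTime m) (hT : PolyTime T) :
    PolyTime fun x : List Bool × (ℕ × ℕ) => M.clash (s x.1) (m x.1) (T x.1) x.2.1 x.2.2 := by
  classical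
  let _ : DecidableEq M.Sym := Classical.decEq _
  have h1 : PolyTime fun a : List Bool × ℕ => a.1 := .fst .id
  have hcell : PolyTime fun a : List Bool × ℕ => a.2 / M.numSym :=
    (PolyTime.divMod (.snd .id) (.const M.numSym) fun _ => M.numSym_pos).fst
  have hti : PolyTime fun a : List Bool × ℕ =>
      (a.2 / M.numSym / (T a.1 + 1), a.2 / M.numSym % (T a.1 + 1)) :=
    hcell.divMod (hT.comp h1).succ fun _ => Nat.succ_pos _
  have ht : PolyTime fun a : List Bool × ℕ => (M.decode (T a.1 + 1) a.2).1 := hti.fst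
  have hi : PolyTime fun a : List Bool × ℕ => (M.decode (T a.1 + 1) a.2).2.1 := hti.snd
  have hsym : FinTime fun a : List Bool × ℕ => (M.decode (T a.1 + 1) a.2).2.2 := fun g => by
    refine (PolyTime.eq (PolyTime.divMod (.snd .id) (.const M.numSym) fun _ => M.numSym_pos).snd
      (.const (Fintype.equivFin M.Sym g).val)).congr fun a => ?_
    rw [decide_eq_decide]
    change _ ↔ (Fintype.equivFin M.Sym).symm ⟨_, Nat.mod_lt _ M.numSym_pos⟩ = g
    rw [Equiv.symm_apply_eq, Fin.ext_iff]
    rfl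
  have hentry : PolyTime fun a : List Bool × ℕ =>
      decide (M.EntryCond (s a.1) (m a.1) (T a.1) (M.decode (T a.1 + 1) a.2)) := by
    have hlen := (hs.comp h1).length
    refine ((((FinTime.of_bool (ht.eq (.const 0))).pair (.of_bool (ht.eq (hT.comp h1)))).pair
      ((FinTime.of_bool (hi.lt hlen)).pair (.of_bool ((hs.comp h1).getD hi)))).pair
      ((FinTime.of_bool (hi.lt (hlen.add (hm.comp h1)))).pair hsym)).polyTime
      (fun c => decide (M.EntryOK (c.1.1.1 = true) (c.1.1.2 = true) (c.1.2.1 = true) c.1.2.2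
        (c.2.1 = true) c.2.2)) |>.congr fun a => ?_
    simp only [decide_eq_true_eq, Machine.EntryCond]
    congr
  have hu : PolyTime fun x : List Bool × (ℕ × ℕ) => (x.1, x.2.1) :=
    (PolyTime.fst .id).pair (.fst (.snd .id))
  have hv : PolyTime fun x : List Bool × (ℕ × ℕ) => (x.1, x.2.2) :=
    (PolyTime.fst .id).pair (.snd (.snd .id))
  have hpair : PolyTime fun x : List Bool × (ℕ × ℕ) =>
      decide (M.PairCond (M.decode (T x.1 + 1) x.2.1) (M.decode (T x.1 + 1) x.2.2)) := by
    have ht1 := ht.comp hu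
    have ht2 := ht.comp hv
    have hi1 := hi.comp hu
    have hi2 := hi.comp hv
    refine ((((FinTime.of_bool (ht1.eq ht2)).pair (.of_bool (ht2.eq ht1.succ))).pair
      (((FinTime.of_bool (hi1.eq hi2)).pair (.of_bool (hi2.eq hi1.succ))).pair
      (.of_bool (hi1.eq hi2.succ)))).pair
      (((FinTime.of_bool (hi1.eq (.const 0))).pair (.of_bool (hi2.eq (.const 0)))).pair
      ((hsym.comp hu).pair (hsym.comp hv)))).polyTime
      (fun c => decide (M.PairOK (c.1.1.1 = true) (c.1.1.2 = true) (c.1.2.1.1 = true)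
        (c.1.2.1.2 = true) (c.1.2.2 = true) (c.2.1.1 = true) (c.2.1.2 = true)
        c.2.2.1 c.2.2.2)) |>.congr fun a => ?_
    simp only [decide_eq_true_eq, Machine.PairCond]
    congr
  refine ((hentry.comp hu).and ((hentry.comp hv).and hpair)).not.congr fun x => ?_
  simp only [← Bool.decide_and, ← decide_not, Machine.clash]

/-- The part `1 x₁ 1 x₂ … 1 xₙ 0` of the code of a pair. -/
theorem PolyTime.pairPrefix :
    PolyTime fun x : List Bool => x.flatMap (fun b => [true, b]) ++ [false] := by
  refine ((flatMap (G := fun (x : List Bool) i => [true, x.getD i false]) (length .id)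
    (cons true (singleton (getD (fst .id) (snd .id))))).append (const [false])).congr fun x => ?_
  congr 1
  have hx : x = (List.range x.length).map fun i => x.getD i false := by
    refine List.ext_getElem (by simp) fun i h _ => ?_
    simp [h]
  conv_rhs => rw [hx, List.flatMap_map]

/-- For each language in NP there is a family of graphs, given in polynomial time, such that
membership is a bound on the size of a vertex cover. -/
theorem exists_vertexCover_of_mem_NP {L : Language Bool} (hL : L ∈ NP) :
    ∃ (n k : List Bool → ℕ) (r : List Bool → ℕ → ℕ → Bool), PolyTime n ∧ PolyTime k ∧
      (PolyTime fun x : List Bool × (ℕ × ℕ) => r x.1 x.2.1 x.2.2) ∧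
      ∀ x, x ∈ L ↔ ∃ S : Set (Fin (n x)), (relGraph (n x) (r x)).IsVertexCover S ∧
        S.ncard ≤ k x := by
  obtain ⟨V, ⟨M, q, hM, hV⟩, p, hp⟩ := hL
  -- The successor in the definition of `T` makes the tableau have more than one entry.
  let s : List Bool → List Bool := fun x => x.flatMap (fun b => [true, b]) ++ [false]
  let m : List Bool → ℕ := fun x => p.eval x.length
  let T : List Bool → ℕ := fun x => q.eval ((s x).length + m x) + 1
  have hs : PolyTime s := .pairPrefix
  have hm : PolyTime m := PolyTime.eval (.length .id) p
  have hT : PolyTime T := ((hs.length.add hm).eval q).succ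
  have hR : PolyTime fun x => (T x + 1) * (T x + 1) := hT.succ.mul hT.succ
  have hn : PolyTime fun x => (T x + 1) * (T x + 1) * M.numSym := hR.mul (.const _)
  refine ⟨_, _, fun x => M.clash (s x) (m x) (T x), hn, hn.sub hR, M.polyTime_clash hs hm hT,
    fun x => ?_⟩
  rw [M.exists_isVertexCover_clash_iff _ _ (Nat.succ_pos _), hp]
  -- The verifier has halted after `T x - 1` steps, so it is in the same state after `T x` steps.
  have hiff (w : List Bool) (hw : w.length = m x) :
      pair x w ∈ V ↔ M.HaltsWithin id (s x ++ w) (T x) true := by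
    have e : pair x w = s x ++ w := by simp [pair, s]
    obtain ⟨b, hb, hbV⟩ := hV (pair x w)
    have hb' : M.HaltsWithin id (s x ++ w) (T x) b := by
      rw [e, List.length_append, hw] at hb
      simp only [T, Machine.HaltsWithin, Nat.add_comm _ 1, Function.iterate_add_apply]
      rw [← Function.iterate_add_apply, Nat.add_comm 1, Function.iterate_succ_apply']
      have := Machine.iterate_step_of_halt (f := id) hb 1
      rw [iterate_one] at this
      rw [this]
      exact hb
    rw [← hbV]
    unfold Machine.HaltsWithin at *
    rw [hb']
    simp
  constructor
  · rintro ⟨w, hw, hwV⟩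
    have h := Machine.exists_isTableau hM ((hiff w hw).1 hwV)
    rw [hw] at h
    exact h
  · rintro ⟨A, hA⟩
    obtain ⟨w, hw, h⟩ := hA.exists_haltsWithin hM
    exact ⟨w, hw, (hiff w hw).2 h⟩

end Complexity

theorem theorem1 : Complexity.NPHard Complexity.StrongEdgeProblem := by
  intro L hL
  obtain ⟨n, k, r, hn, hk, hr, h⟩ := Complexity.exists_vertexCover_of_mem_NP hL
  exact Complexity.exists_machine_of_vertexCover hn hr hk h
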